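/- Let $K$ be a field of characteristic zero or $K=\mathbb Z$, and let $\Sigma_0$ be a seed of geometric type over $K$, with $n$ exchangeable variables, $m$ frozen variables and ambient field $\mathcal F$. That is, $\Sigma_0=(\mathbf x^0,\mathbf y,B^0)$, where $x^0_1,\dots,x^0_n,y_1,\dots,y_m$ are algebraically independent over $K$ and generate $\mathcal F$ as a field over $\mathbf q(K)$, the fraction field of $K$, and $B^0$ is an $(n+m)\times n$ integer matrix whose top $n\times n$ part is skew-symmetrizable. If $K$ is a field, assume moreover that no exchangeable index is isolated, i.e. that no column of $B^0$ is zero. Mutation of a seed $(\mathbf x,\mathbf y,B)$ in direction $i\in[1,n]$ keeps $\mathbf y$ and, writing $x_{n+j}=y_j$, replaces $x_i$ by $$x_i'=\frac1{x_i}\Bigl(\prod_{b_{ki}>0}x_k^{b_{ki}}+\prod_{b_{ki}<0}x_k^{-b_{ki}}\Bigr)$$ and $B$ by the matrix with entries $-b_{jk}$ if $j=i$ or $k=i$, and $b_{jk}+\frac12(|b_{ji}|b_{ik}+b_{ji}|b_{ik}|)$ otherwise. Seeds obtained from $\Sigma_0$ by finitely many mutations are called mutation-equivalent to $\Sigma_0$.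 Let $\mathcal A\subseteq\mathcal F$ be the cluster algebra of $\Sigma_0$, i.e. the $K$-algebra generated by the exchangeable variables of all seeds mutation-equivalent to $\Sigma_0$ together with $y_1^{\pm1},\dots,y_m^{\pm1}$. Let $\mathcal U\subseteq\mathcal F$ be the upper cluster algebra, i.e. the intersection of the Laurent polynomial rings $K[x_1^{\pm1},\dots,x_n^{\pm1},y_1^{\pm1},\dots,y_m^{\pm1}]$ over all seeds $(\mathbf x,\mathbf y,B)$ mutation-equivalent to $\Sigma_0$. For a domain $R$ and $u\in R$, let $\llbracket u\rrbracket_R=\{a\in R : a\mid u^N\text{ in }R\text{ for some }N\ge 0\}$ be the divisor-closed submonoid generated by $u$. Let $(\mathbf x,\mathbf y,B)$ be any seed mutation-equivalent to $\Sigma_0$ and let $e_1,\dots,e_n\ge 0$ be integers. Then $x_1^{e_1}\cdots x_n^{e_n}$ lies in both $\mathcal A$ and $\mathcal U$, and $$\llbracket x_1^{e_1}\cdots x_n^{e_n}\rrbracket_{\mathcal U}=\llbracket x_1^{e_1}\cdots x_n^{e_n}\rrbracket_{\mathcal A}=\{\varepsilon x_1^{a_1}\cdots x_n^{a_n} : \varepsilon\in\mathcal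 U^\times,\ a_i\in\mathbb Z_{\ge0},\ a_i=0\text{ whenever }e_i=0\}.$$ In particular, this monoid is free abelian up to units: its quotient by its group of units is a free abelian monoid whose basis is the family of the classes of the $x_i$ with $e_i\ne0$. -/

import Mathlib

namespace ClusterAlg

universe u v

/-- The data `(𝐱, 𝐲, B)` of a labeled seed with `n` exchangeable and `m` frozen variables in the
field `F`.  The rows of `B` are indexed by all variables, the columns by the exchangeable ones.
The conditions that make such a triple a seed are in `IsSeed`. -/
structure SeedData (n m : ℕ) (F : Type v) where
  x : Fin n → F
  y : Fin m → F
  B : Matrix (Fin n ⊕ Fin m) (Fin n) ℤ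

/-- A square integer matrix is skew-symmetrizable if `D * C` is skew-symmetric for some diagonal
matrix `D` with positive integer diagonal entries. -/
def IsSkewSymmetrizable {n : ℕ} (C : Matrix (Fin n) (Fin n) ℤ) : Prop :=
  ∃ d : Fin n → ℕ, (∀ i, 0 < d i) ∧ ∀ i j, (d i : ℤ) * C i j = -((d j : ℤ) * C j i)

/-- An exchange matrix is an `(n + m) × n` integer matrix whose principal part is
skew-symmetrizable. -/
def IsExchangeMatrix {n m : ℕ} (B : Matrix (Fin n ⊕ Fin m) (Fin n) ℤ) : Prop :=
  IsSkewSymmetrizable (fun i j => B (Sum.inl i) j)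

namespace SeedData

variable {n m : ℕ} {F : Type v}

/-- All `n + m` variables, the exchangeable ones first. -/
def vars (s : SeedData n m F) : Fin n ⊕ Fin m → F := Sum.elim s.x s.y

/-- The exchangeable index `k` is isolated if the quiver of `B` has no arrow at `k`.  For an
exchange matrix, `b_{kj} ≠ 0` iff `b_{jk} ≠ 0` for exchangeable `j`, so this says that the `k`-th
column of `B` vanishes. -/
def IsIsolated (s : SeedData n m F) (k : Fin n) : Prop := ∀ j, s.B j k = 0

variable [Field F]

/-- `s` is a seed over `K` with ambient field `F`: the `n + m` variables are algebraically
independent over `K`, `F` is the field of rational functions in them over the fraction field of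
`K`, and `B` is an exchange matrix. -/
structure IsSeed (K : Type u) [CommRing K] [Algebra K F] (s : SeedData n m F) : Prop where
  algebraicIndependent : AlgebraicIndependent K s.vars
  closure_eq_top : Subfield.closure (Set.range (algebraMap K F) ∪ Set.range s.vars) = ⊤
  isExchangeMatrix : IsExchangeMatrix s.B

/-- The exchange polynomial `f_i = x_i x_i'`:
the sum of `∏_{b_{ki} > 0} x_k ^ b_{ki}` and `∏_{b_{ki} < 0} x_k ^ (-b_{ki})`. -/
def exchange (s : SeedData n m F) (i : Fin n) : F :=
  ∏ k, s.vars k ^ (s.B k i).toNat + ∏ k, s.vars k ^ (-s.B k i).toNat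

/-- Mutation in direction `i`.  The integer `|b_{ji}| b_{ik} + b_{ji} |b_{ik}|` is always even. -/
def mutate (s : SeedData n m F) (i : Fin n) : SeedData n m F where
  x := Function.update s.x i ((s.x i)⁻¹ * s.exchange i)
  y := s.y
  B := fun j k =>
    if j = Sum.inl i ∨ k = i then -s.B j k
    else s.B j k +
      (|s.B j i| * s.B (Sum.inl i) k + s.B j i * |s.B (Sum.inl i) k|) / 2

/-- `t` arises from `s` by a finite sequence of mutations. -/
def MutEquiv (s t : SeedData n m F) : Prop :=
  Relation.ReflTransGen (fun a b => ∃ i, b = a.mutate i) s t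

/-- The set of cluster variables: all exchangeable variables of all seeds mutation-equivalent
to `s`. -/
def clusterVars (s : SeedData n m F) : Set F := {z | ∃ t, MutEquiv s t ∧ z ∈ Set.range t.x}

variable (K : Type u) [CommRing K] [Algebra K F]

/-- The cluster algebra `K[x, y^{±1} | x a cluster variable, y a frozen variable]`. -/
def clusterAlgebra (s : SeedData n m F) : Subalgebra K F :=
  Algebra.adjoin K (s.clusterVars ∪ Set.range s.y ∪ Set.range (fun j => (s.y j)⁻¹))

/-- The Laurent polynomial ring `K[u^{±1} | u ∈ 𝐱 ∪ 𝐲]` inside the ambient field. -/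
def laurent (s : SeedData n m F) : Subalgebra K F :=
  Algebra.adjoin K (Set.range s.vars ∪ Set.range (fun k => (s.vars k)⁻¹))

/-- The upper cluster algebra: the intersection of the Laurent polynomial rings of all seeds
mutation-equivalent to `s`. -/
def upperClusterAlgebra (s : SeedData n m F) : Subalgebra K F :=
  ⨅ (t : SeedData n m F) (_ : MutEquiv s t), t.laurent K

/-- The monomial `x_1 ^ e_1 ⋯ x_n ^ e_n` in the exchangeable variables of `s`. -/
def monomial (s : SeedData n m F) (e : Fin n → ℕ) : F := ∏ i, s.x i ^ e i

end SeedData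

/-- The divisor-closed submonoid generated by `S`: all elements that divide (in `H`) an element of
the submonoid generated by `S`. -/
def divisorClosure {H : Type v} [CommMonoid H] (S : Set H) : Submonoid H where
  carrier := {a | ∃ s ∈ Submonoid.closure S, a ∣ s}
  one_mem' := ⟨1, one_mem _, dvd_rfl⟩
  mul_mem' := by
    rintro a b ⟨s, hs, has⟩ ⟨t, ht, hbt⟩
    exact ⟨s * t, mul_mem hs ht, mul_dvd_mul has hbt⟩

/-- The commutative monoid `H` is free abelian with basis `b`: every element is a product
`∏ b_i ^ a_i` for exactly one finitely supported family of exponents `a_i ∈ ℕ`. -/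
def IsFreeAbelianOn {ι : Type u} {H : Type v} [CommMonoid H] (b : ι → H) : Prop :=
  Function.Bijective (fun a : ι →₀ ℕ => a.prod fun i k => b i ^ k)

end ClusterAlg

/-! Both algebras are sandwiched: each contains the variables of the seed `s` and the inverses of
the frozen ones, and each lies in the Laurent ring of `s` and of every one-step mutation of `s`.
Only this (`IsIntermediate`) enters the study of divisors.

If `z * w` is a monomial in the exchangeable variables, then `z` is invertible in the Laurent ring
of `s`, hence a unit of `K` times a Laurent monomial (`exists_eq_laurentMonomial_of_mul_eq_one`). A
negative exponent at `x_i` is impossible: since `z` is also a Laurent polynomial after mutation at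
`i`, it would make the exchange polynomial `f_i = x_i x_i'` invertible there. But `f_i` is a sum of
two distinct monomials, or, at an isolated index, equal to `2`, which is no unit of `ℤ`
(`IsPreseed.exponent_nonneg`). So the divisors are described by `s` and `K` alone, identically for
both algebras, and freeness is uniqueness of exponents.

What remains is that the sandwich is real, that is, the Laurent phenomenon `MutEquiv.x_mem_laurent`.
For an exchange matrix with independent columns, lying in the Laurent rings of a seed and of all its
neighbours is inherited by each neighbour (`IsPreseed.mem_laurent_mutate_mutate`), by an argument on
two directions at a time. The general case follows by specialization: attach `n` further frozen
variables `1 + X_q` with the identity matrix as coefficients, which forces full rank, and set `X =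
0`. Working over power series keeps this specialization defined along every mutation, as a series
with nonzero constant coefficient is invertible. -/

namespace ClusterAlg

universe u v

/-! ### Laurent algebras as images of the group algebra of `ℤ^ι`. -/

section LaurentAlg

variable {ι : Type*} {F : Type*} [Field F]

/-- The Laurent monomial with exponent vector `α`. -/
def laurentMonomial [Fintype ι] (v : ι → F) (α : ι → ℤ) : F := ∏ i, v i ^ α i

variable (K : Type*) [CommRing K] [Algebra K F]

/-- The algebra of Laurent polynomials in the family `v`. -/
def laurentAlg (v : ι → F) : Subalgebra K F :=
  Algebra.adjoin K (Set.range v ∪ Set.range (fun k => (v k)⁻¹))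

/-- The algebra of Laurent polynomials in the members of `v` with index different from `j`. -/
def laurentRest (v : ι → F) (j : ι) : Subalgebra K F :=
  Algebra.adjoin K {x | ∃ i, i ≠ j ∧ (x = v i ∨ x = (v i)⁻¹)}

variable {K}

lemma mem_laurentAlg (v : ι → F) (i : ι) : v i ∈ laurentAlg K v :=
  Algebra.subset_adjoin (Or.inl ⟨i, rfl⟩)

lemma inv_mem_laurentAlg (v : ι → F) (i : ι) : (v i)⁻¹ ∈ laurentAlg K v :=
  Algebra.subset_adjoin (Or.inr ⟨i, rfl⟩)

lemma zpow_mem_laurentAlg (v : ι → F) (i : ι) (d : ℤ) : v i ^ d ∈ laurentAlg K v := by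
  obtain ⟨k, rfl | rfl⟩ := d.eq_nat_or_neg
  · simpa using pow_mem (mem_laurentAlg v i) k
  · simpa using pow_mem (inv_mem_laurentAlg (K := K) v i) k

lemma mem_laurentRest (v : ι → F) {i j : ι} (h : i ≠ j) : v i ∈ laurentRest K v j :=
  Algebra.subset_adjoin ⟨i, h, Or.inl rfl⟩

lemma inv_mem_laurentRest (v : ι → F) {i j : ι} (h : i ≠ j) : (v i)⁻¹ ∈ laurentRest K v j :=
  Algebra.subset_adjoin ⟨i, h, Or.inr rfl⟩

lemma zpow_mem_laurentRest (v : ι → F) {i j : ι} (h : i ≠ j) (d : ℤ) :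
    v i ^ d ∈ laurentRest K v j := by
  obtain ⟨k, rfl | rfl⟩ := d.eq_nat_or_neg
  · simpa using pow_mem (mem_laurentRest v h) k
  · simpa using pow_mem (inv_mem_laurentRest (K := K) v h) k

lemma laurentRest_le_iff {v : ι → F} {j : ι} {S : Subalgebra K F} :
    laurentRest K v j ≤ S ↔ ∀ i, i ≠ j → v i ∈ S ∧ (v i)⁻¹ ∈ S := by
  constructor
  · exact fun h i hi => ⟨h (mem_laurentRest v hi), h (inv_mem_laurentRest v hi)⟩
  · intro h
    refine Algebra.adjoin_le ?_
    rintro _ ⟨i, hi, rfl | rfl⟩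
    exacts [(h i hi).1, (h i hi).2]

lemma laurentAlg_le_iff {v : ι → F} {S : Subalgebra K F} :
    laurentAlg K v ≤ S ↔ ∀ i, v i ∈ S ∧ (v i)⁻¹ ∈ S := by
  constructor
  · exact fun h i => ⟨h (mem_laurentAlg v i), h (inv_mem_laurentAlg v i)⟩
  · intro h
    refine Algebra.adjoin_le ?_
    rintro _ (⟨i, rfl⟩ | ⟨i, rfl⟩)
    exacts [(h i).1, (h i).2]

lemma laurentRest_le (v : ι → F) (j : ι) : laurentRest K v j ≤ laurentAlg K v :=
  laurentRest_le_iff.2 fun i _ => ⟨mem_laurentAlg v i, inv_mem_laurentAlg v i⟩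

/-- The Laurent rings before and after an exchange at `j` share this coefficient ring; that is what
allows comparing expansions. -/
lemma laurentRest_update [DecidableEq ι] (v : ι → F) (j : ι) (y : F) :
    laurentRest K (Function.update v j y) j = laurentRest K v j := by
  apply le_antisymm <;> rw [laurentRest_le_iff] <;> intro i hi
  · rw [Function.update_of_ne hi]
    exact ⟨mem_laurentRest v hi, inv_mem_laurentRest v hi⟩
  · have h : v i = Function.update v j y i := by rw [Function.update_of_ne hi]
    rw [h]
    exact ⟨mem_laurentRest _ hi, inv_mem_laurentRest _ hi⟩

variable [Fintype ι]

lemma laurentMonomial_mem (v : ι → F) (α : ι → ℤ) : laurentMonomial v α ∈ laurentAlg K v :=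
  prod_mem fun i _ => zpow_mem_laurentAlg v i _

lemma laurentMonomial_mem_rest (v : ι → F) {j : ι} {α : ι → ℤ} (h : α j = 0) :
    laurentMonomial v α ∈ laurentRest K v j := by
  refine prod_mem fun i _ => ?_
  by_cases hi : i = j
  · subst hi; simp [h, one_mem]
  · exact zpow_mem_laurentRest v hi _

lemma laurentMonomial_add {v : ι → F} (hv : ∀ i, v i ≠ 0) (α β : ι → ℤ) :
    laurentMonomial v (α + β) = laurentMonomial v α * laurentMonomial v β := by
  simp [laurentMonomial, zpow_add₀ (hv _), Finset.prod_mul_distrib]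

@[simp] lemma laurentMonomial_zero (v : ι → F) : laurentMonomial v 0 = 1 := by
  simp [laurentMonomial]

lemma laurentMonomial_ne_zero {v : ι → F} (hv : ∀ i, v i ≠ 0) (α : ι → ℤ) :
    laurentMonomial v α ≠ 0 :=
  Finset.prod_ne_zero_iff.2 fun i _ => zpow_ne_zero _ (hv i)

lemma laurentMonomial_single [DecidableEq ι] (v : ι → F) (j : ι) (d : ℤ) :
    laurentMonomial v (Pi.single j d) = v j ^ d := by
  rw [laurentMonomial, Finset.prod_eq_single j]
  · simp
  · intro b _ hb; simp [hb]
  · simp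

variable (K)

/-- Evaluation of Laurent polynomials, in the form of elements of the group algebra of `ℤ^ι`. -/
noncomputable def laurentHom {v : ι → F} (hv : ∀ i, v i ≠ 0) :
    AddMonoidAlgebra K (ι → ℤ) →ₐ[K] F :=
  AddMonoidAlgebra.lift K F (ι → ℤ)
    { toFun := fun α => laurentMonomial v α.toAdd
      map_one' := by simp
      map_mul' := fun α β => by simp [laurentMonomial_add hv] }

variable {K}

lemma laurentHom_single {v : ι → F} (hv : ∀ i, v i ≠ 0) (α : ι → ℤ) (c : K) :
    laurentHom K hv (AddMonoidAlgebra.single α c) = algebraMap K F c * laurentMonomial v α := by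
  simp [laurentHom, AddMonoidAlgebra.lift_single, Algebra.smul_def]

lemma laurentHom_eq_sum {v : ι → F} (hv : ∀ i, v i ≠ 0) (a : AddMonoidAlgebra K (ι → ℤ)) :
    laurentHom K hv a = ∑ α ∈ a.coeff.support, algebraMap K F (a.coeff α) * laurentMonomial v α := by
  conv_lhs => rw [← AddMonoidAlgebra.sum_coeff_single a]
  rw [Finsupp.sum, map_sum]
  simp only [laurentHom_single]

lemma laurentHom_mem {v : ι → F} (hv : ∀ i, v i ≠ 0) (a : AddMonoidAlgebra K (ι → ℤ)) :
    laurentHom K hv a ∈ laurentAlg K v := by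
  rw [laurentHom_eq_sum]
  exact sum_mem fun α _ => mul_mem (algebraMap_mem _ _) (laurentMonomial_mem v α)

lemma mem_laurentAlg_iff {v : ι → F} (hv : ∀ i, v i ≠ 0) {z : F} :
    z ∈ laurentAlg K v ↔ ∃ a, laurentHom K hv a = z := by
  classical
  constructor
  · intro h
    have : laurentAlg K v ≤ (laurentHom K hv).range := by
      rw [laurentAlg_le_iff]
      intro i
      refine ⟨⟨AddMonoidAlgebra.single (Pi.single i 1) 1, ?_⟩,
        ⟨AddMonoidAlgebra.single (Pi.single i (-1)) 1, ?_⟩⟩ <;>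
      · simp [laurentHom_single, laurentMonomial_single]
    exact this h
  · rintro ⟨a, rfl⟩
    exact laurentHom_mem hv a

lemma laurentMonomial_natCast (v : ι → F) (α : ι →₀ ℕ) :
    laurentMonomial v (fun i => (α i : ℤ)) = α.prod fun i k => v i ^ k := by
  rw [Finsupp.prod_fintype _ _ (fun i => pow_zero _)]
  simp [laurentMonomial]

/-- Multiplying by a large monomial turns a Laurent relation into a polynomial one, which algebraic
independence kills. -/
lemma laurentHom_injective {v : ι → F} (hv : ∀ i, v i ≠ 0) (h : AlgebraicIndependent K v) :
    Function.Injective (laurentHom K hv) := by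
  rw [injective_iff_map_eq_zero]
  intro a ha
  -- Dominates every exponent in the support, so that the shift by `β` makes all of them
  -- nonnegative.
  set β : ι → ℤ := fun i => ∑ α ∈ a.coeff.support, |α i| with hβ
  have hpos : ∀ α ∈ a.coeff.support, ∀ i, 0 ≤ α i + β i := by
    intro α hα i
    have h1 : |α i| ≤ β i :=
      Finset.single_le_sum (f := fun α : ι → ℤ => |α i|) (fun _ _ => abs_nonneg _) hα
    have := neg_abs_le (α i)
    linarith
  let e : (ι → ℤ) → ι →₀ ℕ := fun α => Finsupp.equivFunOnFinite.symm fun i => (α i + β i).toNat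
  have he : ∀ α ∈ a.coeff.support, ∀ i, ((e α i : ℕ) : ℤ) = α i + β i := by
    intro α hα i
    simp [e, Int.toNat_of_nonneg (hpos α hα i)]
  have hinj : ∀ α ∈ a.coeff.support, ∀ α' ∈ a.coeff.support, e α = e α' → α = α' := by
    intro α hα α' hα' hee
    funext i
    have h1 := he α hα i
    have h2 := he α' hα' i
    rw [hee] at h1
    linarith
  let Q : MvPolynomial ι K := ∑ α ∈ a.coeff.support, MvPolynomial.monomial (e α) (a.coeff α)
  have hQ : MvPolynomial.aeval v Q = 0 := by
    have h1 : MvPolynomial.aeval v Q = laurentHom K hv a * laurentMonomial v β := by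
      rw [laurentHom_eq_sum, Finset.sum_mul, map_sum]
      refine Finset.sum_congr rfl fun α hα => ?_
      rw [MvPolynomial.aeval_monomial, mul_assoc, ← laurentMonomial_add hv,
        ← laurentMonomial_natCast]
      congr 2
      funext i
      exact he α hα i
    rw [h1, ha, zero_mul]
  have hQ0 : Q = 0 := (map_eq_zero_iff _ h).1 hQ
  apply AddMonoidAlgebra.coeff_injective
  ext α
  by_contra hne
  have hα : α ∈ a.coeff.support := Finsupp.mem_support_iff.2 hne
  have h2 : MvPolynomial.coeff (e α) Q = a.coeff α := by
    classical
    simp only [Q, MvPolynomial.coeff_sum, MvPolynomial.coeff_monomial]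
    rw [Finset.sum_eq_single α]
    · simp
    · intro α' hα' hne'
      rw [if_neg fun h => hne' (hinj _ hα' _ hα h)]
    · exact fun h => absurd hα h
  rw [hQ0] at h2
  exact hne (by simpa using h2.symm)

end LaurentAlg

/-! ### Exchanging a single variable. -/

section LaurentAlg

variable {ι : Type*} {F : Type*} [Field F] {K : Type*} [CommRing K] [Algebra K F]

lemma algebraicIndependent_iff_of_ne [DecidableEq ι] (v : ι → F) (j : ι) :
    AlgebraicIndependent K v ↔ AlgebraicIndependent K (fun i : {i // i ≠ j} => v i) ∧
      Transcendental (Algebra.adjoin K (Set.range fun i : {i // i ≠ j} => v i)) (v j) := by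
  rw [← AlgebraicIndependent.option_iff, ← algebraicIndependent_equiv (Equiv.optionSubtypeNe j)]
  have : v ∘ Equiv.optionSubtypeNe j = fun o => o.elim (v j) fun i : {i // i ≠ j} => v i := by
    funext o
    cases o <;> simp
  rw [this]

/-- If `f / v_j` were algebraic over the other variables, so would be `v_j`, being the quotient of
`f ≠ 0` by it. -/
lemma algebraicIndependent_update [DecidableEq ι] {v : ι → F} (hv : AlgebraicIndependent K v)
    {j : ι} {f : F} (hf : f ∈ Algebra.adjoin K (Set.range fun i : {i // i ≠ j} => v i))
    (hf0 : f ≠ 0) : AlgebraicIndependent K (Function.update v j ((v j)⁻¹ * f)) := by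
  rw [algebraicIndependent_iff_of_ne _ j] at hv ⊢
  have hrest : (fun i : {i // i ≠ j} => Function.update v j ((v j)⁻¹ * f) i) =
      fun i : {i // i ≠ j} => v i := by
    funext i
    rw [Function.update_of_ne i.2]
  rw [hrest]
  refine ⟨hv.1, fun h => hv.2 ?_⟩
  rw [Function.update_self] at h
  have h1 : IsAlgebraic (Algebra.adjoin K (Set.range fun i : {i // i ≠ j} => v i)) f :=
    isAlgebraic_algebraMap (⟨f, hf⟩ : Algebra.adjoin K _)
  have h2 := h1.inv.mul h
  rw [mul_left_comm, inv_mul_cancel₀ hf0, mul_one] at h2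
  simpa using h2.inv

/-- The elements of `F` that some power of `q` multiplies into `L`. -/
def powInvSubalgebra (L : Subalgebra K F) {q : F} (hq : q ∈ L) : Subalgebra K F where
  carrier := {z | ∃ N : ℕ, z * q ^ N ∈ L}
  algebraMap_mem' r := ⟨0, by simp⟩
  add_mem' := by
    rintro x y ⟨M, hM⟩ ⟨N, hN⟩
    refine ⟨M + N, ?_⟩
    have : (x + y) * q ^ (M + N) = x * q ^ M * q ^ N + y * q ^ N * q ^ M := by ring
    rw [this]
    exact add_mem (mul_mem hM (pow_mem hq _)) (mul_mem hN (pow_mem hq _))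
  mul_mem' := by
    rintro x y ⟨M, hM⟩ ⟨N, hN⟩
    refine ⟨M + N, ?_⟩
    have : (x * y) * q ^ (M + N) = (x * q ^ M) * (y * q ^ N) := by ring
    rw [this]
    exact mul_mem hM hN

lemma le_powInvSubalgebra (L : Subalgebra K F) {q : F} (hq : q ∈ L) :
    L ≤ powInvSubalgebra L hq := fun z hz => ⟨0, by simpa using hz⟩

/-- Powers of comaximal elements are comaximal, so a denominator that is at once a power of `p` and
a power of `q` is trivial. -/
lemma mem_of_isCoprime {L : Subalgebra K F} {p q a b z : F} (hp : p ∈ L) (hq : q ∈ L)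
    (ha : a ∈ L) (hb : b ∈ L) (hab : a * p + b * q = 1) {M N : ℕ} (hM : z * p ^ M ∈ L)
    (hN : z * q ^ N ∈ L) : z ∈ L := by
  have h : IsCoprime (⟨p, hp⟩ : L) ⟨q, hq⟩ := ⟨⟨a, ha⟩, ⟨b, hb⟩, Subtype.ext hab⟩
  obtain ⟨c, d, hcd⟩ := h.pow (m := M) (n := N)
  have h1 : (c : F) * p ^ M + d * q ^ N = 1 := congrArg Subtype.val hcd
  have h2 : z = c * (z * p ^ M) + d * (z * q ^ N) := by linear_combination (-z) * h1
  rw [h2]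
  exact add_mem (mul_mem c.2 hM) (mul_mem d.2 hN)

/-- With `w_j = f / v_j` one has `v_j = f / w_j` and `v_j⁻¹ = w_j / f`: the exchange introduces only
powers of `f` as denominators. -/
lemma exists_mul_pow_mem_laurentAlg_update [DecidableEq ι] {v : ι → F} {j : ι} {f z : F}
    (hv : v j ≠ 0) (hf : f ∈ laurentRest K v j) (hf0 : f ≠ 0) (hz : z ∈ laurentAlg K v) :
    ∃ N : ℕ, z * f ^ N ∈ laurentAlg K (Function.update v j ((v j)⁻¹ * f)) := by
  set w := Function.update v j ((v j)⁻¹ * f) with hw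
  have hwj : w j = (v j)⁻¹ * f := by simp [hw]
  have hrest : laurentRest K v j ≤ laurentAlg K w := by
    rw [← laurentRest_update v j ((v j)⁻¹ * f)]
    exact laurentRest_le _ _
  have hfw := hrest hf
  have key : laurentAlg K v ≤ powInvSubalgebra (laurentAlg K w) hfw := by
    rw [laurentAlg_le_iff]
    intro i
    by_cases hi : i = j
    · subst hi
      refine ⟨⟨0, ?_⟩, ⟨1, ?_⟩⟩
      · have : v i * f ^ 0 = f * (w i)⁻¹ := by
          rw [hwj]; field_simp
        rw [this]
        exact mul_mem hfw (inv_mem_laurentAlg w i)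
      · have : (v i)⁻¹ * f ^ 1 = w i := by rw [hwj, pow_one]
        rw [this]
        exact mem_laurentAlg w i
    · exact ⟨le_powInvSubalgebra _ hfw (hrest (mem_laurentRest v hi)),
        le_powInvSubalgebra _ hfw (hrest (inv_mem_laurentRest v hi))⟩
  exact key hz

variable [Fintype ι]

lemma laurentAlg_exists_sum [DecidableEq ι] {v : ι → F} (hv : ∀ i, v i ≠ 0) {z : F}
    (hz : z ∈ laurentAlg K v) (j : ι) :
    ∃ (D : Finset ℤ) (r : ℤ → F), (∀ d, r d ∈ laurentRest K v j) ∧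
      z = ∑ d ∈ D, r d * v j ^ d := by
  obtain ⟨a, rfl⟩ := (mem_laurentAlg_iff hv).1 hz
  refine ⟨a.coeff.support.image fun α => α j, fun d => ∑ α ∈ a.coeff.support with α j = d,
    algebraMap K F (a.coeff α) * laurentMonomial v (α - Pi.single j (α j)), ?_, ?_⟩
  · intro d
    refine sum_mem fun α _ => mul_mem (algebraMap_mem _ _) (laurentMonomial_mem_rest _ ?_)
    simp
  · rw [laurentHom_eq_sum,
      ← Finset.sum_fiberwise_of_maps_to (t := a.coeff.support.image fun α => α j) (g := fun α => α j) (fun α hα => Finset.mem_image_of_mem _ hα)]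
    refine Finset.sum_congr rfl fun d _ => ?_
    rw [Finset.sum_mul]
    refine Finset.sum_congr rfl fun α hα => ?_
    rw [← (Finset.mem_filter.1 hα).2, mul_assoc, ← laurentMonomial_single v j,
      ← laurentMonomial_add hv, sub_add_cancel]

open DirectSum AddMonoidAlgebra

/-- The exponent of the variable `j`, as a degree function. -/
abbrev expDegree (j : ι) : (ι → ℤ) →+ ℤ := Pi.evalAddMonoidHom (fun _ => ℤ) j

lemma laurentHom_mem_rest {v : ι → F} (hv : ∀ i, v i ≠ 0) {j : ι}
    {a : AddMonoidAlgebra K (ι → ℤ)} (ha : a ∈ gradeBy K (expDegree j) 0) :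
    laurentHom K hv a ∈ laurentRest K v j := by
  rw [laurentHom_eq_sum]
  exact sum_mem fun α hα => mul_mem (algebraMap_mem _ _) (laurentMonomial_mem_rest _ (ha α hα))

lemma exists_of_mem_laurentRest [DecidableEq ι] {v : ι → F} (hv : ∀ i, v i ≠ 0) {j : ι} {z : F}
    (hz : z ∈ laurentRest K v j) :
    ∃ a ∈ gradeBy K (expDegree j) 0, laurentHom K hv a = z := by
  induction hz using Algebra.adjoin_induction with
  | mem x hx =>
    obtain ⟨i, hi, rfl | rfl⟩ := hx
    · refine ⟨single (Pi.single i 1) 1, ?_, by simp [laurentHom_single, laurentMonomial_single]⟩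
      have := single_mem_gradeBy (expDegree j) (Pi.single i 1 : ι → ℤ) (1 : K)
      simpa [hi.symm] using this
    · refine ⟨single (Pi.single i (-1)) 1, ?_, by simp [laurentHom_single, laurentMonomial_single]⟩
      have := single_mem_gradeBy (expDegree j) (Pi.single i (-1) : ι → ℤ) (1 : K)
      simpa [hi.symm] using this
  | algebraMap r =>
    exact ⟨algebraMap K _ r, SetLike.algebraMap_mem_graded _ r, (laurentHom K hv).commutes r⟩
  | add x y _ _ hx hy =>
    obtain ⟨a, ha, rfl⟩ := hx
    obtain ⟨b, hb, rfl⟩ := hy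
    exact ⟨a + b, add_mem ha hb, map_add _ _ _⟩
  | mul x y _ _ hx hy =>
    obtain ⟨a, ha, rfl⟩ := hx
    obtain ⟨b, hb, rfl⟩ := hy
    refine ⟨a * b, ?_, map_mul _ _ _⟩
    have := SetLike.mul_mem_graded ha hb
    rwa [add_zero] at this

/-- Expand `z` in powers of `v_j` and in powers of `f / v_j`, with coefficients free of `v_j`. The
parts of nonnegative degree in `v_j` use only `v_j`. By comparison, a part of degree `e ≤ 0` is a
coefficient times `(f / v_j) ^ (-e)`. So `z` is a polynomial in `v_j` and `f / v_j` over the common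
coefficients. -/
lemma mem_of_mem_laurentAlg_of_mem_update [DecidableEq ι] {v : ι → F}
    (hind : AlgebraicIndependent K v) (hv : ∀ i, v i ≠ 0) {j : ι} {f z : F}
    (hf : f ∈ laurentRest K v j) (hf0 : f ≠ 0)
    (hz : z ∈ laurentAlg K v) (hz' : z ∈ laurentAlg K (Function.update v j ((v j)⁻¹ * f)))
    {S : Subalgebra K F} (hS : laurentRest K v j ≤ S) (hvS : v j ∈ S) (hvS' : (v j)⁻¹ * f ∈ S) :
    z ∈ S := by
  classical
  have hinj := laurentHom_injective hv hind
  set w := Function.update v j ((v j)⁻¹ * f) with hw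
  have hwj : w j = (v j)⁻¹ * f := by simp [hw]
  have hwv : ∀ i, w i ≠ 0 := by
    intro i
    by_cases hi : i = j
    · subst hi; rw [hwj]; exact mul_ne_zero (inv_ne_zero (hv i)) hf0
    · rw [hw, Function.update_of_ne hi]; exact hv i
  obtain ⟨D, c, hc, hsum⟩ := laurentAlg_exists_sum hwv hz' j
  rw [laurentRest_update] at hc
  rw [hwj] at hsum
  obtain ⟨a, rfl⟩ := (mem_laurentAlg_iff hv).1 hz
  obtain ⟨φ, hφ, hφf⟩ := exists_of_mem_laurentRest hv hf
  -- Multiplication by `f ^ N` removes the negative powers of `f` in the second expansion, so that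
  -- both can be compared inside the group algebra.
  obtain ⟨N, hN⟩ : ∃ N : ℕ, ∀ d ∈ D, 0 ≤ N + d := by
    refine ⟨∑ d ∈ D, d.natAbs, fun d hd => ?_⟩
    have := Finset.single_le_sum (f := Int.natAbs) (fun _ _ => Nat.zero_le _) hd
    omega
  have hr : ∀ d, ∃ ρ ∈ gradeBy K (expDegree j) 0,
      laurentHom K hv ρ = c d * f ^ (N + d).toNat := fun d =>
    exists_of_mem_laurentRest hv (mul_mem (hc d) (pow_mem hf _))
  choose ρ hρ hρf using hr
  have hpow : φ ^ N ∈ gradeBy K (expDegree j) 0 := by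
    have := SetLike.pow_mem_graded N hφ
    rwa [smul_zero] at this
  have heq : φ ^ N * a = ∑ d ∈ D, ρ d * single (Pi.single j (-d)) 1 := by
    apply hinj
    rw [map_mul, map_pow, map_sum, hφf, hsum, Finset.mul_sum]
    refine Finset.sum_congr rfl fun d hd => ?_
    rw [map_mul, hρf, laurentHom_single, laurentMonomial_single, map_one, one_mul,
      ← zpow_natCast f (N + d).toNat, Int.toNat_of_nonneg (hN d hd), zpow_add₀ hf0, mul_zpow,
      inv_zpow, zpow_neg, zpow_natCast]
    ring
  have hterm : ∀ d, ρ d * single (Pi.single j (-d)) 1 ∈ gradeBy K (expDegree j) (-d) := by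
    intro d
    have h1 := single_mem_gradeBy (expDegree j) (Pi.single j (-d) : ι → ℤ) (1 : K)
    have := SetLike.mul_mem_graded (hρ d) h1
    simpa using this
  -- The factor `φ ^ N` has degree zero, so it passes through the degree decomposition.
  have hcomp : ∀ e : ℤ, φ ^ N * (decompose (gradeBy K (expDegree j)) a e : AddMonoidAlgebra K _) =
      if -e ∈ D then ρ (-e) * single (Pi.single j e) 1 else 0 := by
    intro e
    rw [← coe_decompose_mul_of_left_mem_zero _ hpow, heq, decompose_sum,
      DFinsupp.finsetSum_apply, AddSubmonoidClass.coe_finsetSum]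
    have : ∀ d ∈ D, ((decompose (gradeBy K (expDegree j)) (ρ d * single (Pi.single j (-d)) 1) e :
        gradeBy K (expDegree j) e) : AddMonoidAlgebra K _) =
        if d = -e then ρ (-e) * single (Pi.single j e) 1 else 0 := by
      intro d _
      split_ifs with h
      · subst h
        have hm := hterm (-e)
        rw [neg_neg] at hm ⊢
        exact decompose_of_mem_same _ hm
      · exact decompose_of_mem_ne _ (hterm d) (by omega)
    rw [Finset.sum_congr rfl this, Finset.sum_ite_eq']
  rw [← sum_support_decompose (gradeBy K (expDegree j)) a, map_sum]
  refine sum_mem fun e _ => ?_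
  obtain he | he := le_total 0 e
  · have h1 := single_mem_gradeBy (expDegree j) (Pi.single j (-e) : ι → ℤ) (1 : K)
    have h2 := SetLike.mul_mem_graded (SetLike.coe_mem (decompose (gradeBy K (expDegree j)) a e)) h1
    have h3 : expDegree j (Pi.single j (-e)) = -e := by simp
    rw [h3, add_neg_cancel] at h2
    have h4 := hS (laurentHom_mem_rest hv h2)
    have h5 := mul_mem h4 (pow_mem hvS e.toNat)
    rw [map_mul, laurentHom_single, laurentMonomial_single, ← zpow_natCast,
      Int.toNat_of_nonneg he, mul_assoc, mul_assoc, ← zpow_add₀ (hv j)] at h5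
    simpa using h5
  · have h1 := congrArg (laurentHom K hv) (hcomp e)
    rw [map_mul, map_pow, hφf] at h1
    split_ifs at h1 with h
    · rw [map_mul, hρf, laurentHom_single, laurentMonomial_single, map_one, one_mul,
        ← zpow_natCast f (N + -e).toNat, Int.toNat_of_nonneg (hN _ h), zpow_add₀ hf0,
        zpow_natCast] at h1
      have h2 : laurentHom K hv (decompose (gradeBy K (expDegree j)) a e) =
          c (-e) * ((v j)⁻¹ * f) ^ (-e).toNat := by
        apply mul_left_cancel₀ (pow_ne_zero N hf0)
        rw [h1, ← zpow_natCast _ (-e).toNat, Int.toNat_of_nonneg (by omega), mul_zpow, inv_zpow,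
          zpow_neg (v j), inv_inv]
        ring
      rw [h2]
      exact mul_mem (hS (hc _)) (pow_mem hvS' _)
    · rw [map_zero] at h1
      rw [(mul_eq_zero.1 h1).resolve_left (pow_ne_zero N hf0)]
      exact zero_mem _

end LaurentAlg

/-! ### Homogeneous divisors, units and binomials in group algebras. -/

section LaurentAlg

open DirectSum AddMonoidAlgebra

section Grading

variable {M : Type*} [AddCommGroup M] {K : Type*} [CommRing K]

lemma dvd_component_of_dvd {ℓ : M →+ ℤ} {d : ℤ} {f b : AddMonoidAlgebra K M}
    (hf : f ∈ gradeBy K ℓ d) (h : f ∣ b) (i : ℤ) : f ∣ (decompose (gradeBy K ℓ) b i : K[M]) := by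
  obtain ⟨c, rfl⟩ := h
  have := coe_decompose_mul_add_of_left_mem (gradeBy K ℓ) (j := i - d) (b := c) hf
  rw [add_sub_cancel] at this
  rw [this]
  exact dvd_mul_right _ _

/-- A homogeneous divisor divides each graded component. The components of the product are `a_i x^γ
+ a_{i-e} x^δ` with `e ≠ 0`, so divisibility of `a_{i-e}` passes to `a_i`; the recursion starts at a
vanishing component, which exists since the support is finite. -/
lemma dvd_of_dvd_mul_binomial {ℓ : M →+ ℤ} {d : ℤ} {f a : AddMonoidAlgebra K M}
    (hf : f ∈ gradeBy K ℓ d) {γ δ : M} (hγδ : ℓ γ ≠ ℓ δ)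
    (h : f ∣ a * (single γ 1 + single δ 1)) : f ∣ a := by
  classical
  set e := ℓ δ - ℓ γ with he
  have he0 : e ≠ 0 := sub_ne_zero.2 hγδ.symm
  have hunit : ∀ x : K[M], f ∣ x * single γ 1 → f ∣ x := by
    intro x hx
    have h1 := hx.mul_right (single (-γ) (1 : K))
    rw [mul_assoc, single_mul_single, add_neg_cancel, one_mul,
      ← AddMonoidAlgebra.one_def, mul_one] at h1
    exact h1
  have hstep : ∀ i, f ∣ (decompose (gradeBy K ℓ) a (i - e) : K[M]) →
      f ∣ (decompose (gradeBy K ℓ) a i : K[M]) := by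
    intro i hi
    have h1 := dvd_component_of_dvd hf h (i + ℓ γ)
    have h2 := coe_decompose_mul_add_of_right_mem (gradeBy K ℓ) (i := i) (a := a)
      (single_mem_gradeBy ℓ γ (1 : K))
    have h3 := coe_decompose_mul_add_of_right_mem (gradeBy K ℓ) (i := i - e) (a := a)
      (single_mem_gradeBy ℓ δ (1 : K))
    have h4 : i - e + ℓ δ = i + ℓ γ := by omega
    rw [h4] at h3
    rw [mul_add, decompose_add, DirectSum.add_apply, Submodule.coe_add, h2, h3] at h1
    exact hunit _ ((dvd_add_left (hi.mul_right _)).1 h1)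
  have hind : ∀ (N : ℕ) (i : ℤ), decompose (gradeBy K ℓ) a (i - N * e) = 0 →
      f ∣ (decompose (gradeBy K ℓ) a i : K[M]) := by
    intro N
    induction N with
    | zero =>
      intro i hi
      rw [Nat.cast_zero, zero_mul, sub_zero] at hi
      simp [hi]
    | succ N ih =>
      intro i hi
      refine hstep i (ih _ ?_)
      have : i - e - N * e = i - (N + 1 : ℕ) * e := by push_cast; ring
      rwa [this]
  rw [← sum_support_decompose (gradeBy K ℓ) a]
  refine Finset.dvd_sum fun i _ => ?_
  obtain ⟨N, hN⟩ : ∃ N : ℕ, i - N * e ∉ (decompose (gradeBy K ℓ) a).support := by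
    have hinj : Function.Injective fun N : ℕ => i - N * e := fun N N' h => by
      have h1 : (N : ℤ) * e = N' * e := sub_right_injective h
      exact_mod_cast mul_right_cancel₀ he0 h1
    obtain ⟨x, ⟨N, rfl⟩, hx⟩ :=
      (Set.infinite_range_of_injective hinj).exists_notMem_finset
        (decompose (gradeBy K ℓ) a).support
    exact ⟨N, hx⟩
  exact hind N i (by simpa using hN)

end Grading

section Units

variable {M : Type*} [AddCommGroup M] [TwoUniqueSums M] {K : Type*} [CommRing K] [IsDomain K]

/-- If the supports of `a` and its inverse had more than one pair of exponents, two distinct pairs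
would have uniquely represented sums. Both sums then occur in `a * b = 1`, so both are `0`,
contradicting uniqueness. -/
lemma exists_eq_single_of_isUnit {a : AddMonoidAlgebra K M} (ha : IsUnit a) :
    ∃ (α : M) (c : K), IsUnit c ∧ a = single α c := by
  obtain ⟨b, hab⟩ := ha.exists_right_inv
  have hcard : ¬ 1 < a.coeff.support.card * b.coeff.support.card := by
    intro h
    obtain ⟨p, hp, q, hq, hpq, hup, huq⟩ := TwoUniqueSums.uniqueAdd_of_one_lt_card h
    rw [Finset.mem_product, Finsupp.mem_support_iff, Finsupp.mem_support_iff] at hp hq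
    have key : ∀ r : M × M, UniqueAdd a.coeff.support b.coeff.support r.1 r.2 →
        a.coeff r.1 ≠ 0 ∧ b.coeff r.2 ≠ 0 → r.1 + r.2 = 0 := by
      intro r hr h0
      have h1 := coeff_mul_add_of_uniqueAdd hr
      rw [hab, AddMonoidAlgebra.one_def, coeff_single] at h1
      by_contra hne
      rw [Finsupp.single_eq_of_ne hne] at h1
      exact mul_ne_zero h0.1 h0.2 h1.symm
    have h1 := hup (Finsupp.mem_support_iff.2 hq.1) (Finsupp.mem_support_iff.2 hq.2)
      ((key q huq hq).trans (key p hup hp).symm)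
    exact hpq (Prod.ext h1.1.symm h1.2.symm)
  have hne : ∀ x y : K[M], x * y = 1 → x.coeff.support.card ≠ 0 := by
    intro x y hxy h0
    rw [Finset.card_eq_zero, Finsupp.support_eq_empty, coeff_eq_zero] at h0
    rw [h0, zero_mul] at hxy
    exact zero_ne_one hxy
  have hcb := hne b a (by rw [mul_comm, hab])
  have hca := hne a b hab
  have ha1 : a.coeff.support.card = 1 := by
    have := Nat.le_of_not_lt hcard
    nlinarith [Nat.pos_of_ne_zero hca, Nat.pos_of_ne_zero hcb]
  have hb1 : b.coeff.support.card = 1 := by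
    have := Nat.le_of_not_lt hcard
    nlinarith [Nat.pos_of_ne_zero hca, Nat.pos_of_ne_zero hcb]
  obtain ⟨α, c, hc, hac⟩ := Finsupp.card_support_eq_one'.1 ha1
  obtain ⟨β, d, hd, hbd⟩ := Finsupp.card_support_eq_one'.1 hb1
  have ha' : a = single α c := coeff_injective hac
  have hb' : b = single β d := coeff_injective hbd
  refine ⟨α, c, ?_, ha'⟩
  rw [ha', hb', single_mul_single, AddMonoidAlgebra.one_def] at hab
  have h1 := congrArg coeff hab
  rw [coeff_single, coeff_single, Finsupp.single_eq_single_iff] at h1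
  rcases h1 with h1 | h1
  · exact IsUnit.of_mul_eq_one _ h1.2
  · exact absurd h1.2 one_ne_zero

end Units

variable {ι : Type*} {F : Type*} [Field F] {K : Type*} [CommRing K] [Algebra K F] [Fintype ι]

/-- Under `ℓ` the binomial `f` is homogeneous and `g` is not, so `f` can be cancelled against powers
of `g`. This replaces coprimality of `f` and `g` without unique factorization. -/
lemma mem_laurentAlg_of_binomials {v : ι → F} (hind : AlgebraicIndependent K v)
    (hv : ∀ i, v i ≠ 0) {ℓ : (ι → ℤ) →+ ℤ} {α β γ δ : ι → ℤ} (hαβ : ℓ α = ℓ β) (hγδ : ℓ γ ≠ ℓ δ)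
    {f g z : F} (hf : f = laurentMonomial v α + laurentMonomial v β)
    (hg : g = laurentMonomial v γ + laurentMonomial v δ) (hf0 : f ≠ 0) {M N : ℕ}
    (hM : z * f ^ M ∈ laurentAlg K v) (hN : z * g ^ N ∈ laurentAlg K v) :
    z ∈ laurentAlg K v := by
  have hinj := laurentHom_injective hv hind
  set φ : AddMonoidAlgebra K (ι → ℤ) := single α 1 + single β 1 with hφ
  set ψ : AddMonoidAlgebra K (ι → ℤ) := single γ 1 + single δ 1 with hψ
  have hφf : laurentHom K hv φ = f := by simp [hφ, hf, laurentHom_single]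
  have hψg : laurentHom K hv ψ = g := by simp [hψ, hg, laurentHom_single]
  have hhom : φ ∈ gradeBy K ℓ (ℓ α) := by
    refine add_mem (single_mem_gradeBy ℓ α 1) ?_
    rw [hαβ]
    exact single_mem_gradeBy ℓ β 1
  have hdvd : ∀ (N : ℕ) (a : AddMonoidAlgebra K (ι → ℤ)), φ ∣ a * ψ ^ N → φ ∣ a := by
    intro N
    induction N with
    | zero => intro a h; simpa using h
    | succ N ih =>
      intro a h
      rw [pow_succ, ← mul_assoc] at h
      exact ih a (dvd_of_dvd_mul_binomial hhom hγδ h)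
  have hfL : f ∈ laurentAlg K v := hφf ▸ laurentHom_mem hv φ
  induction M with
  | zero => simpa using hM
  | succ M ih =>
    apply ih
    obtain ⟨a, ha⟩ := (mem_laurentAlg_iff hv).1 hM
    obtain ⟨b, hb⟩ := (mem_laurentAlg_iff hv).1 (mul_mem hN (pow_mem hfL M))
    obtain ⟨c, rfl⟩ := hdvd N a ⟨b, hinj (by
      rw [map_mul, map_mul, map_pow, ha, hb, hφf, hψg]; ring)⟩
    rw [map_mul, hφf, pow_succ, ← mul_assoc, mul_comm] at ha
    rw [← mul_right_cancel₀ hf0 ha]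
    exact laurentHom_mem hv c

lemma exists_eq_laurentMonomial_of_mul_eq_one [IsDomain K] {v : ι → F}
    (hind : AlgebraicIndependent K v) (hv : ∀ i, v i ≠ 0) {z w : F} (hz : z ∈ laurentAlg K v)
    (hw : w ∈ laurentAlg K v) (hzw : z * w = 1) :
    ∃ (c : K) (α : ι → ℤ), IsUnit c ∧ z = algebraMap K F c * laurentMonomial v α := by
  obtain ⟨a, rfl⟩ := (mem_laurentAlg_iff hv).1 hz
  obtain ⟨b, rfl⟩ := (mem_laurentAlg_iff hv).1 hw
  have hab : a * b = 1 := laurentHom_injective hv hind (by rw [map_mul, hzw, map_one])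
  obtain ⟨α, c, hc, rfl⟩ := exists_eq_single_of_isUnit (IsUnit.of_mul_eq_one b hab)
  exact ⟨c, α, hc, laurentHom_single hv α c⟩

lemma laurentMonomial_exponent_unique {v : ι → F}
    (hind : AlgebraicIndependent K v) (hv : ∀ i, v i ≠ 0) {c c' : K} (hc : c ≠ 0) {α β : ι → ℤ}
    (h : algebraMap K F c * laurentMonomial v α = algebraMap K F c' * laurentMonomial v β) :
    α = β := by
  rw [← laurentHom_single hv, ← laurentHom_single hv] at h
  have h1 := congrArg coeff (laurentHom_injective hv hind h)
  rw [coeff_single, coeff_single, Finsupp.single_eq_single_iff] at h1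
  exact h1.elim (fun h => h.1) fun h => absurd h.1 hc

/-- Characteristic zero matters when the two monomials coincide and the sum is twice a monomial. -/
lemma binomial_ne_zero [CharZero K] {v : ι → F}
    (hind : AlgebraicIndependent K v) (hv : ∀ i, v i ≠ 0) (α β : ι → ℤ) :
    laurentMonomial v α + laurentMonomial v β ≠ 0 := by
  classical
  intro h
  have h1 : laurentHom K hv (single α 1 + single β 1) = laurentHom K hv 0 := by
    simpa [laurentHom_single] using h
  have h2 := congrArg (fun a => coeff a α) (laurentHom_injective hv hind h1)
  simp only [coeff_add, coeff_single, Finsupp.add_apply, Finsupp.single_apply, coeff_zero,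
    Finsupp.zero_apply, if_true] at h2
  split_ifs at h2
  · norm_num [one_add_one_eq_two] at h2
  · simp at h2

/-- A binomial with distinct monomials is not invertible; neither is `2 x ^ α` if `2` is not. -/
lemma binomial_mul_ne_one [IsDomain K] {v : ι → F}
    (hind : AlgebraicIndependent K v) (hv : ∀ i, v i ≠ 0) {α β : ι → ℤ}
    (hαβ : α ≠ β ∨ ¬ IsUnit (2 : K)) {w : F} (hw : w ∈ laurentAlg K v) :
    (laurentMonomial v α + laurentMonomial v β) * w ≠ 1 := by
  classical
  intro h
  obtain ⟨b, rfl⟩ := (mem_laurentAlg_iff hv).1 hw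
  have hab : (single α 1 + single β 1) * b = 1 := laurentHom_injective hv hind (by
    rw [map_mul, map_one, ← h]; simp [laurentHom_single])
  obtain ⟨γ, c, hc, heq⟩ := exists_eq_single_of_isUnit (IsUnit.of_mul_eq_one b hab)
  have hne : α = β := by
    by_contra hne
    have h1 := congrArg (fun a => coeff a α) heq
    have h2 := congrArg (fun a => coeff a β) heq
    simp only [coeff_add, coeff_single, Finsupp.add_apply, Finsupp.single_apply, if_true] at h1 h2
    rw [if_neg (Ne.symm hne), add_zero] at h1
    rw [if_neg hne, zero_add] at h2
    by_cases hγ : γ = α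
    · rw [if_neg (fun h => hne (hγ.symm.trans h))] at h2
      exact one_ne_zero h2
    · rw [if_neg hγ] at h1
      exact one_ne_zero h1
  subst hne
  have h1 := congrArg (fun a => coeff a α) heq
  simp only [coeff_add, coeff_single, Finsupp.add_apply, Finsupp.single_apply, if_true] at h1
  rw [one_add_one_eq_two] at h1
  by_cases hγ : γ = α
  · rw [if_pos hγ] at h1
    exact (hαβ.resolve_left fun h => h rfl) (h1 ▸ hc)
  · have h2 := congrArg (fun a => coeff a γ) heq
    simp only [coeff_add, coeff_single, Finsupp.add_apply, Finsupp.single_apply, if_true] at h2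
    rw [if_neg (Ne.symm hγ), add_zero] at h2
    exact not_isUnit_zero (h2 ▸ hc)

end LaurentAlg

/-! ### Exchange binomials and two successive exchanges. -/

section Exchange

variable {ι : Type*} [Fintype ι] {F : Type*} [Field F]

/-- The binomial `∏ v_i ^ β_i⁺ + ∏ v_i ^ β_i⁻`. -/
def exchangeBinomial (v : ι → F) (β : ι → ℤ) : F :=
  ∏ k, v k ^ (β k).toNat + ∏ k, v k ^ (-β k).toNat

lemma exchangeBinomial_neg (v : ι → F) (β : ι → ℤ) :
    exchangeBinomial v (fun i => -β i) = exchangeBinomial v β := by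
  simp [exchangeBinomial, add_comm]

lemma exchangeBinomial_update [DecidableEq ι] (v : ι → F) {β : ι → ℤ} {j : ι} (h : β j = 0)
    (y : F) : exchangeBinomial (Function.update v j y) β = exchangeBinomial v β := by
  unfold exchangeBinomial
  congr 1 <;>
  · refine Finset.prod_congr rfl fun i _ => ?_
    by_cases hi : i = j
    · subst hi; simp [h]
    · rw [Function.update_of_ne hi]

lemma exchangeBinomial_eq (v : ι → F) (β : ι → ℤ) :
    exchangeBinomial v β = laurentMonomial v (fun i => ((β i).toNat : ℤ)) +
      laurentMonomial v (fun i => ((-β i).toNat : ℤ)) := by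
  simp only [exchangeBinomial, laurentMonomial, zpow_natCast]

variable {K : Type*} [CommRing K] [Algebra K F]

lemma exchangeBinomial_mem_adjoin (v : ι → F) {β : ι → ℤ} {j : ι} (h : β j = 0) :
    exchangeBinomial v β ∈ Algebra.adjoin K (Set.range fun i : {i // i ≠ j} => v i) := by
  refine add_mem (prod_mem fun i _ => ?_) (prod_mem fun i _ => ?_) <;>
  · by_cases hi : i = j
    · subst hi; simp [h, one_mem]
    · exact pow_mem (Algebra.subset_adjoin (Set.mem_range_self (⟨i, hi⟩ : {i // i ≠ j}))) _

lemma exchangeBinomial_mem_rest (v : ι → F) {β : ι → ℤ} {j : ι} (h : β j = 0) :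
    exchangeBinomial v β ∈ laurentRest K v j := by
  rw [exchangeBinomial_eq]
  exact add_mem (laurentMonomial_mem_rest v (by simp [h])) (laurentMonomial_mem_rest v (by simp [h]))

lemma exchangeBinomial_ne_zero [CharZero K] {v : ι → F} (hind : AlgebraicIndependent K v)
    (β : ι → ℤ) : exchangeBinomial v β ≠ 0 := by
  have : Nontrivial K := ⟨1, 0, one_ne_zero⟩
  rw [exchangeBinomial_eq]
  exact binomial_ne_zero hind (fun i => hind.ne_zero i) _ _

variable [DecidableEq ι]

/-- Replace `v_j` by `v_j⁻¹ (∏ v_i ^ β_i⁺ + ∏ v_i ^ β_i⁻)`. -/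
def exchangeAt (v : ι → F) (j : ι) (β : ι → ℤ) : ι → F :=
  Function.update v j ((v j)⁻¹ * exchangeBinomial v β)

lemma exchangeAt_self (v : ι → F) (j : ι) (β : ι → ℤ) :
    exchangeAt v j β j = (v j)⁻¹ * exchangeBinomial v β := Function.update_self ..

lemma exchangeAt_of_ne (v : ι → F) {i j : ι} (h : i ≠ j) (β : ι → ℤ) :
    exchangeAt v j β i = v i := Function.update_of_ne h ..

lemma algebraicIndependent_exchangeAt [CharZero K] {v : ι → F} (hind : AlgebraicIndependent K v)
    {j : ι} {β : ι → ℤ} (h : β j = 0) : AlgebraicIndependent K (exchangeAt v j β) :=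
  algebraicIndependent_update hind (exchangeBinomial_mem_adjoin v h)
    (exchangeBinomial_ne_zero hind β)

/-- Exchanges at two indices that do not interact. -/
lemma mem_laurentAlg_exchange_of_commute [CharZero K] {v : ι → F}
    (hind : AlgebraicIndependent K v) {j k : ι} (hjk : j ≠ k) {β γ : ι → ℤ} (hβj : β j = 0)
    (hβk : β k = 0) (hγj : γ j = 0) (hγk : γ k = 0)
    {ℓ : (ι → ℤ) →+ ℤ} (hβ : ℓ β = 0) (hγ : ℓ γ ≠ 0) {z : F}
    (hzk : z ∈ laurentAlg K (exchangeAt v k γ)) (hzj : z ∈ laurentAlg K (exchangeAt v j β)) :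
    z ∈ laurentAlg K (exchangeAt (exchangeAt v k γ) j β) := by
  have : Nontrivial K := ⟨1, 0, one_ne_zero⟩
  have hind1 := algebraicIndependent_exchangeAt hind hγk
  have hind2 := algebraicIndependent_exchangeAt hind1 hβj
  have hind3 := algebraicIndependent_exchangeAt hind hβj
  -- The exchanges commute, so the target ring is reached by two routes. One leaves a power of the
  -- first binomial as denominator of `z`, the other a power of the second.
  have hcomm : exchangeAt (exchangeAt v k γ) j β = exchangeAt (exchangeAt v j β) k γ := by
    simp only [exchangeAt]
    rw [exchangeBinomial_update v hβk, exchangeBinomial_update v hγj,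
      Function.update_of_ne hjk, Function.update_of_ne hjk.symm, Function.update_comm hjk.symm]
  obtain ⟨M, hM⟩ := exists_mul_pow_mem_laurentAlg_update (hind1.ne_zero j)
    (exchangeBinomial_mem_rest _ hβj) (exchangeBinomial_ne_zero hind1 β) hzk
  obtain ⟨N, hN⟩ := exists_mul_pow_mem_laurentAlg_update (hind3.ne_zero k)
    (exchangeBinomial_mem_rest _ hγk) (exchangeBinomial_ne_zero hind3 γ) hzj
  have hsplit : ∀ δ : ι → ℤ, ℓ (fun i => ((δ i).toNat : ℤ)) - ℓ (fun i => ((-δ i).toNat : ℤ)) =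
      ℓ δ := by
    intro δ
    rw [← map_sub]
    congr 1
    funext i
    exact Int.toNat_sub_toNat_neg _
  have h1 := hsplit β
  have h2 := hsplit γ
  refine mem_laurentAlg_of_binomials (f := exchangeBinomial (exchangeAt v k γ) β)
    (g := exchangeBinomial (exchangeAt v j β) γ) hind2 (fun i => hind2.ne_zero i) (ℓ := ℓ)
    (α := fun i => ((β i).toNat : ℤ)) (β := fun i => ((-β i).toNat : ℤ))
    (γ := fun i => ((γ i).toNat : ℤ)) (δ := fun i => ((-γ i).toNat : ℤ)) (by omega) (by omega) ?_ ?_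
    (exchangeBinomial_ne_zero hind1 β) hM (N := N) ?_
  · rw [← exchangeBinomial_eq]
    exact (exchangeBinomial_update _ hβj _).symm
  · rw [← exchangeBinomial_eq, hcomm]
    exact (exchangeBinomial_update _ hγk _).symm
  · rw [hcomm]; exact hN

/-- The part of a monomial away from the indices `j` and `k`. -/
def monomialAway (v : ι → F) (j k : ι) (e : ι → ℕ) : F :=
  ∏ i ∈ (Finset.univ.erase k).erase j, v i ^ e i

lemma prod_pow_eq_monomialAway (v : ι → F) {j k : ι} (hjk : j ≠ k) (e : ι → ℕ) :
    ∏ i, v i ^ e i = v k ^ e k * (v j ^ e j * monomialAway v j k e) := by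
  rw [monomialAway, Finset.mul_prod_erase _ (fun i => v i ^ e i) (by simp [hjk]),
    Finset.mul_prod_erase _ (fun i => v i ^ e i) (by simp)]

lemma monomialAway_congr {v w : ι → F} {j k : ι} (h : ∀ i, i ≠ j → i ≠ k → w i = v i)
    (e : ι → ℕ) : monomialAway w j k e = monomialAway v j k e := by
  refine Finset.prod_congr rfl fun i hi => ?_
  simp only [Finset.mem_erase] at hi
  rw [h i hi.1 hi.2.1]

/-- Exchanges at two interacting indices. -/
lemma mem_laurentAlg_exchange_of_pos [CharZero K] {v : ι → F}
    (hind : AlgebraicIndependent K v) {j k : ι} (hjk : j ≠ k) {β β' γ : ι → ℤ} {b c : ℕ}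
    (hβj : β j = 0) (hβk : β k = c) (hγj : γ j = -(b + 1 : ℕ)) (hγk : γ k = 0)
    (hβ'j : β' j = 0) (hβ'k : β' k = -c)
    (hβ' : ∀ i, i ≠ k → β' i = β i + c * max (γ i) 0) {z : F}
    (hz : z ∈ laurentAlg K v)
    (hzk : z ∈ laurentAlg K (exchangeAt v k γ)) (hzj : z ∈ laurentAlg K (exchangeAt v j β)) :
    z ∈ laurentAlg K (exchangeAt (exchangeAt v k γ) j β') := by
  have : Nontrivial K := ⟨1, 0, one_ne_zero⟩
  have hind1 := algebraicIndependent_exchangeAt hind hγk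
  have hind2 := algebraicIndependent_exchangeAt hind1 hβ'j
  set v1 := exchangeAt v k γ with hv1
  set v2 := exchangeAt v1 j β' with hv2
  set L := laurentAlg K v2 with hL
  -- Plan: `z` lies in `L` up to a power of `q` (expansion around `v`) and up to a power of `p'`
  -- (expansion around `v1`), and `q`, `p'` are comaximal in `L`.
  have hv1j : v1 j = v j := exchangeAt_of_ne v hjk γ
  have hv1k : v1 k = (v k)⁻¹ * exchangeBinomial v γ := exchangeAt_self v k γ
  have hv2k : v2 k = v1 k := exchangeAt_of_ne v1 hjk.symm β'
  have hv2j : v2 j = (v j)⁻¹ * exchangeBinomial v1 β' := by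
    rw [hv2, exchangeAt_self, hv1j]
  have hv1i : ∀ i, i ≠ j → i ≠ k → v1 i = v i := fun i _ hik => exchangeAt_of_ne v hik γ
  have hv2i : ∀ i, i ≠ j → i ≠ k → v2 i = v i := fun i hij hik => by
    rw [hv2, exchangeAt_of_ne v1 hij, hv1i i hij hik]
  set P := monomialAway v j k fun i => (β i).toNat with hP
  set Q := monomialAway v j k fun i => (-β i).toNat with hQ
  set P' := monomialAway v j k fun i => (β' i).toNat with hP'
  set Q' := monomialAway v j k fun i => (-β' i).toNat with hQ'
  set R := monomialAway v j k fun i => (γ i).toNat with hR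
  set S := monomialAway v j k fun i => (-γ i).toNat with hS
  have hmem : ∀ e : ι → ℕ, monomialAway v j k e ∈ L := fun e => by
    rw [← monomialAway_congr hv2i]
    exact prod_mem fun i _ => pow_mem (mem_laurentAlg v2 i) _
  have hinv : ∀ e : ι → ℕ, (monomialAway v j k e)⁻¹ ∈ L := fun e => by
    rw [← monomialAway_congr hv2i, monomialAway, ← Finset.prod_inv_distrib]
    exact prod_mem fun i _ => by
      rw [← inv_pow]
      exact pow_mem (inv_mem_laurentAlg v2 i) _
  have hne : ∀ e : ι → ℕ, monomialAway v j k e ≠ 0 := fun e =>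
    Finset.prod_ne_zero_iff.2 fun i _ => pow_ne_zero _ (hind.ne_zero i)
  have hp : exchangeBinomial v β = v k ^ c * P + Q := by
    rw [exchangeBinomial, prod_pow_eq_monomialAway v hjk, prod_pow_eq_monomialAway v hjk]
    simp [hβj, hβk, hP, hQ]
  have hq : exchangeBinomial v γ = R + v j ^ (b + 1) * S := by
    rw [exchangeBinomial, prod_pow_eq_monomialAway v hjk, prod_pow_eq_monomialAway v hjk, hγj, hγk,
      neg_neg, Int.toNat_natCast, Int.toNat_neg_natCast]
    simp [hR, hS]
  have hp' : exchangeBinomial v1 β' = P' + v2 k ^ c * Q' := by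
    rw [exchangeBinomial, prod_pow_eq_monomialAway v1 hjk, prod_pow_eq_monomialAway v1 hjk, hβ'j,
      hβ'k, neg_neg, Int.toNat_natCast, Int.toNat_neg_natCast, monomialAway_congr hv1i,
      monomialAway_congr hv1i, hv2k]
    simp [hP', hQ']
  -- The matrix mutation rule for the column of `j`, read exponent by exponent.
  have hrel : P' * Q = Q' * P * R ^ c := by
    simp only [hP', hQ, hQ', hP, hR, monomialAway, ← Finset.prod_pow, ← Finset.prod_mul_distrib,
      ← pow_mul, ← pow_add]
    refine Finset.prod_congr rfl fun i hi => ?_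
    simp only [Finset.mem_erase] at hi
    congr 1
    have h1 := hβ' i hi.2.1
    have h2 : (((γ i).toNat * c : ℕ) : ℤ) = c * max (γ i) 0 := by
      rw [Nat.cast_mul, Int.toNat_eq_max, mul_comm]
    omega
  set p' := exchangeBinomial v1 β' with hp'def
  set q := exchangeBinomial v γ with hqdef
  have hvj0 := hind.ne_zero j
  have hvk0 := hind.ne_zero k
  have hp'0 : p' ≠ 0 := exchangeBinomial_ne_zero hind1 β'
  have hq0 : q ≠ 0 := exchangeBinomial_ne_zero hind γ
  have hv2j0 := hind2.ne_zero j
  have hv2k0 := hind2.ne_zero k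
  have hp'L : p' ∈ L := by
    rw [hp']
    exact add_mem (hmem _) (mul_mem (pow_mem (mem_laurentAlg v2 k) _) (hmem _))
  have hvj : v j = p' * (v2 j)⁻¹ := by rw [hv2j]; field_simp
  have hvjL : v j ∈ L := by
    rw [hvj]
    exact mul_mem hp'L (inv_mem_laurentAlg v2 j)
  have hqL : q ∈ L := by
    rw [hq]
    exact add_mem (hmem _) (mul_mem (pow_mem hvjL _) (hmem _))
  have hvk : v k * v2 k = q := by rw [hv2k, hv1k]; field_simp
  -- The difference `q - R` is a multiple of `v j`, so `q ^ c ≡ R ^ c` modulo `v j`; this makes the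
  -- division by `v j` below possible.
  obtain ⟨T, hTL, hT⟩ : ∃ T ∈ L, T * (q - R) = q ^ c - R ^ c :=
    ⟨_, sum_mem fun i _ => mul_mem (pow_mem hqL _) (pow_mem (hmem _) _), geom_sum₂_mul q R c⟩
  -- The variable obtained by exchanging at `j` directly is Laurent in `v2`: up to units of `L`, its
  -- numerator is `p' * Q` plus a multiple of `v j`, and `p' = v j * v2 j`.
  have hxL : (v j)⁻¹ * exchangeBinomial v β ∈ L := by
    have h1 : (v j)⁻¹ * exchangeBinomial v β =
        (v2 k)⁻¹ ^ c * (v2 j * Q * Q'⁻¹ + P * S * T * v j ^ b) := by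
      have hQ'0 : Q' ≠ 0 := hne _
      have h2 : v2 k ^ c * exchangeBinomial v β * Q' = p' * Q + Q' * P * S * T * v j ^ (b + 1) := by
        have h3 : v2 k ^ c * v k ^ c = q ^ c := by rw [← mul_pow, mul_comm, hvk]
        rw [hp, hp']
        have h4 : T * (v j ^ (b + 1) * S) = q ^ c - R ^ c := by rw [← hT, hq]; ring
        linear_combination P * Q' * h3 - hrel - Q' * P * h4
      rw [hv2j, inv_pow]
      field_simp
      linear_combination h2
    rw [h1]
    refine mul_mem (pow_mem (inv_mem_laurentAlg v2 k) _) (add_mem ?_ ?_)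
    · exact mul_mem (mul_mem (mem_laurentAlg v2 j) (hmem _)) (hinv _)
    · exact mul_mem (mul_mem (mul_mem (hmem _) (hmem _)) hTL) (pow_mem hvjL _)
  -- Of the generators needed, only `(v k)⁻¹ = v2 k / q` fails to lie in `L` for free, whence the
  -- localization at `q`.
  obtain ⟨M, hM⟩ : z ∈ powInvSubalgebra L hqL := by
    have hle := le_powInvSubalgebra L hqL
    refine mem_of_mem_laurentAlg_of_mem_update hind (fun i => hind.ne_zero i)
      (exchangeBinomial_mem_rest v hβj) (exchangeBinomial_ne_zero hind β) hz hzj ?_ (hle hvjL)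
      (hle hxL)
    rw [laurentRest_le_iff]
    intro i hij
    by_cases hik : i = k
    · subst hik
      refine ⟨hle ?_, ⟨1, ?_⟩⟩
      · have : v i = q * (v2 i)⁻¹ := by rw [← hvk]; field_simp
        rw [this]
        exact mul_mem hqL (inv_mem_laurentAlg v2 i)
      · have : (v i)⁻¹ * q ^ 1 = v2 i := by rw [← hvk]; field_simp
        rw [this]
        exact mem_laurentAlg v2 i
    · rw [← hv2i i hij hik]
      exact ⟨hle (mem_laurentAlg v2 i), hle (inv_mem_laurentAlg v2 i)⟩
  obtain ⟨N, hN⟩ := exists_mul_pow_mem_laurentAlg_update (hind1.ne_zero j)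
    (exchangeBinomial_mem_rest v1 hβ'j) hp'0 hzk
  -- Modulo `p'`, hence modulo `v j = p' / v2 j`, the element `q` is the unit `R`. This uses that `v
  -- j` occurs in `q` with positive exponent `b + 1`.
  refine mem_of_isCoprime (a := R⁻¹) (b := -((v2 j)⁻¹ * v j ^ b * S * R⁻¹)) hqL hp'L (hinv _)
    (neg_mem (mul_mem (mul_mem (mul_mem (inv_mem_laurentAlg v2 j) (pow_mem hvjL _)) (hmem _))
      (hinv _))) ?_ hM hN
  have hR0 : R ≠ 0 := hne _
  have h5 : R⁻¹ * R = 1 := inv_mul_cancel₀ hR0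
  rw [hq, pow_succ]
  linear_combination h5 + v j ^ b * S * R⁻¹ * hvj

end Exchange

/-! ### Arithmetic of matrix mutation and sign symmetry. -/

section ExchangeMatrix

lemma two_dvd_abs_mul_add (a b : ℤ) : 2 ∣ |a| * b + a * |b| := by
  obtain ha | ha := abs_choice a <;> obtain hb | hb := abs_choice b <;> rw [ha, hb]
  · exact ⟨a * b, by ring⟩
  · exact ⟨0, by ring⟩
  · exact ⟨0, by ring⟩
  · exact ⟨-(a * b), by ring⟩

lemma mul_div_two_of_nonneg {a b : ℤ} (hb : 0 ≤ b) : (|a| * b + a * |b|) / 2 = b * max a 0 := by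
  apply Int.ediv_eq_of_eq_mul_right two_ne_zero
  rw [abs_of_nonneg hb]
  obtain ha | ha := le_total 0 a
  · rw [abs_of_nonneg ha, max_eq_left ha]; ring
  · rw [abs_of_nonpos ha, max_eq_right ha]; ring

lemma mul_div_two_eq (a b : ℤ) :
    (|a| * b + a * |b|) / 2 = max a 0 * b + a * max (-b) 0 := by
  apply Int.ediv_eq_of_eq_mul_right two_ne_zero
  obtain ha | ha := le_total 0 a <;> obtain hb | hb := le_total 0 b <;>
    simp only [abs_of_nonneg, abs_of_nonpos, max_eq_left, max_eq_right, Left.neg_nonpos_iff,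
      Left.nonneg_neg_iff, ha, hb] <;> ring

lemma mul_div_two_neg (a b : ℤ) :
    (|(-a)| * (-b) + (-a) * |(-b)|) / 2 = -((|a| * b + a * |b|) / 2) := by
  rw [abs_neg, abs_neg, ← Int.neg_ediv_of_dvd (two_dvd_abs_mul_add a b)]
  congr 1
  ring

lemma two_mul_mul_div_two (a b : ℤ) : 2 * ((|a| * b + a * |b|) / 2) = |a| * b + a * |b| :=
  Int.mul_ediv_cancel' (two_dvd_abs_mul_add a b)

variable {n m : ℕ} {B : Matrix (Fin n ⊕ Fin m) (Fin n) ℤ}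

lemma IsExchangeMatrix.diag (hB : IsExchangeMatrix B) (i : Fin n) : B (Sum.inl i) i = 0 := by
  obtain ⟨d, hd, h⟩ := hB
  have h1 := h i i
  have h2 : (d i : ℤ) * B (Sum.inl i) i = 0 := by linarith
  exact (mul_eq_zero.1 h2).resolve_left (by exact_mod_cast (hd i).ne')

lemma IsExchangeMatrix.pos_iff (hB : IsExchangeMatrix B) (i j : Fin n) :
    0 < B (Sum.inl i) j ↔ B (Sum.inl j) i < 0 := by
  obtain ⟨d, hd, h⟩ := hB
  have h1 := h i j
  have hi : (0 : ℤ) < d i := by exact_mod_cast hd i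
  have hj : (0 : ℤ) < d j := by exact_mod_cast hd j
  constructor <;> intro h2 <;> by_contra h3 <;> nlinarith [not_lt.1 h3]

lemma IsExchangeMatrix.eq_zero_iff (hB : IsExchangeMatrix B) (i j : Fin n) :
    B (Sum.inl i) j = 0 ↔ B (Sum.inl j) i = 0 := by
  have h1 := hB.pos_iff i j
  have h2 := hB.pos_iff j i
  omega

end ExchangeMatrix

/-! ### Mutation of seeds, full rank, and the Laurent phenomenon in full rank. -/

namespace SeedData

variable {n m : ℕ} {F : Type v}

/-- The seed with the opposite exchange matrix. -/
def neg (s : SeedData n m F) : SeedData n m F where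
  x := s.x
  y := s.y
  B := -s.B

/-- The columns of the exchange matrix are linearly independent. -/
def HasFullRank (s : SeedData n m F) : Prop :=
  ∀ v : Fin n → ℤ, (∀ j, ∑ k, s.B j k * v k = 0) → v = 0

/-- Two independent columns have a nonzero `2 × 2` minor, and such a minor is the value at the
second column of a functional vanishing on the first. -/
lemma HasFullRank.exists_addMonoidHom {s : SeedData n m F} (hs : s.HasFullRank) {j k : Fin n}
    (hjk : j ≠ k) : ∃ ℓ : (Fin n ⊕ Fin m → ℤ) →+ ℤ,
      ℓ (fun i => s.B i j) = 0 ∧ ℓ (fun i => s.B i k) ≠ 0 := by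
  by_contra! hcon
  have hminor : ∀ p q, s.B p j * s.B q k = s.B q j * s.B p k := by
    intro p q
    have h1 := hcon (s.B p j • Pi.evalAddMonoidHom (fun _ => ℤ) q -
      s.B q j • Pi.evalAddMonoidHom (fun _ => ℤ) p)
    simp only [AddMonoidHom.sub_apply, AddMonoidHom.smul_apply, Pi.evalAddMonoidHom_apply,
      smul_eq_mul] at h1
    have := h1 (by ring)
    linarith
  have hzero : ∀ p, s.B p j = 0 := by
    intro p
    have h1 := hs (Pi.single j (s.B p k) - Pi.single k (s.B p j)) (fun q => by
      simp only [Pi.sub_apply, mul_sub, Finset.sum_sub_distrib, Pi.single_apply, mul_ite, mul_zero,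
        Finset.sum_ite_eq', Finset.mem_univ, if_true]
      have := hminor p q
      linarith)
    have h2 := congrFun h1 k
    simpa [hjk.symm] using h2
  have h1 := hs (Pi.single j 1) (fun q => by simp [Pi.single_apply, hzero])
  have h2 := congrFun h1 j
  simp at h2

variable [Field F]

lemma exchange_eq (s : SeedData n m F) (i : Fin n) :
    s.exchange i = exchangeBinomial s.vars fun k => s.B k i := rfl

lemma vars_mutate (s : SeedData n m F) (i : Fin n) :
    (s.mutate i).vars = exchangeAt s.vars (Sum.inl i) fun k => s.B k i := by
  funext k
  rcases k with k | k
  · by_cases hk : k = i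
    · subst hk
      rw [exchangeAt_self]
      simp [vars, mutate, exchange_eq]
    · rw [exchangeAt_of_ne _ (by simpa using hk)]
      simp [vars, mutate, hk]
  · rw [exchangeAt_of_ne _ (by simp)]
    simp [vars, mutate]

lemma mutate_B (s : SeedData n m F) (i : Fin n) (j : Fin n ⊕ Fin m) (k : Fin n) :
    (s.mutate i).B j k = if j = Sum.inl i ∨ k = i then -s.B j k
      else s.B j k + (|s.B j i| * s.B (Sum.inl i) k + s.B j i * |s.B (Sum.inl i) k|) / 2 := rfl

lemma mutate_neg (s : SeedData n m F) (i : Fin n) : s.neg.mutate i = (s.mutate i).neg := by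
  have hB : (s.neg.mutate i).B = (s.mutate i).neg.B := by
    funext j k
    have h1 : ∀ j k, s.neg.B j k = -s.B j k := fun _ _ => rfl
    have h2 : (s.mutate i).neg.B j k = -(s.mutate i).B j k := rfl
    rw [h2, mutate_B, mutate_B]
    simp only [h1]
    split_ifs
    · rfl
    · rw [mul_div_two_neg]; ring
  have hx : (s.neg.mutate i).x = (s.mutate i).neg.x := by
    have : s.neg.exchange i = s.exchange i := exchangeBinomial_neg s.vars fun k => s.B k i
    show Function.update s.x i ((s.x i)⁻¹ * s.neg.exchange i) =
      Function.update s.x i ((s.x i)⁻¹ * s.exchange i)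
    rw [this]
  have hy : (s.neg.mutate i).y = (s.mutate i).neg.y := rfl
  cases h1 : s.neg.mutate i
  cases h2 : (s.mutate i).neg
  simp_all

/-- The conditions on a seed, without the one on the ambient field. -/
structure IsPreseed (K : Type u) [CommRing K] [Algebra K F] (s : SeedData n m F) : Prop where
  algebraicIndependent : AlgebraicIndependent K s.vars
  isExchangeMatrix : IsExchangeMatrix s.B

variable {K : Type u} [CommRing K] [Algebra K F]

lemma IsSeed.isPreseed {s : SeedData n m F} (hs : s.IsSeed K) : s.IsPreseed K :=
  ⟨hs.1, hs.3⟩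

/-- The same symmetrizer works, because `d_j |b_{ji}| = d_i |b_{ij}|`. -/
lemma isExchangeMatrix_mutate {s : SeedData n m F} (hs : IsExchangeMatrix s.B) (i : Fin n) :
    IsExchangeMatrix (s.mutate i).B := by
  obtain ⟨d, hd, h⟩ := hs
  replace h : ∀ j k, (d j : ℤ) * s.B (Sum.inl j) k = -(d k * s.B (Sum.inl k) j) := h
  refine ⟨d, hd, fun j k => ?_⟩
  show (d j : ℤ) * (s.mutate i).B (Sum.inl j) k = -(d k * (s.mutate i).B (Sum.inl k) j)
  rw [mutate_B, mutate_B]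
  simp only [Sum.inl.injEq]
  by_cases hjk : j = i ∨ k = i
  · rw [if_pos hjk, if_pos hjk.symm]
    have := h j k
    linarith
  · rw [if_neg hjk, if_neg fun h => hjk h.symm]
    set t := (|s.B (Sum.inl j) i| * s.B (Sum.inl i) k + s.B (Sum.inl j) i * |s.B (Sum.inl i) k|) / 2
    set t' := (|s.B (Sum.inl k) i| * s.B (Sum.inl i) j + s.B (Sum.inl k) i * |s.B (Sum.inl i) j|) / 2
    have h1 : 2 * t = _ := two_mul_mul_div_two (s.B (Sum.inl j) i) (s.B (Sum.inl i) k)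
    have h2 : 2 * t' = _ := two_mul_mul_div_two (s.B (Sum.inl k) i) (s.B (Sum.inl i) j)
    have habs : ∀ j, (d j : ℤ) * |s.B (Sum.inl j) i| = d i * |s.B (Sum.inl i) j| := by
      intro j
      have h3 := congrArg abs (h j i)
      rwa [abs_neg, abs_mul, abs_mul, Nat.abs_cast, Nat.abs_cast] at h3
    have h3 := habs j
    have h4 := habs k
    have h5 := h j i
    have h6 := h k i
    have h7 := h j k
    have h8 : 2 * ((d j : ℤ) * t) = -(2 * (d k * t')) := by
      linear_combination (d j : ℤ) * h1 + (d k : ℤ) * h2 + s.B (Sum.inl i) k * h3 +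
        |s.B (Sum.inl i) k| * h5 + s.B (Sum.inl i) j * h4 + |s.B (Sum.inl i) j| * h6
    linarith

lemma IsPreseed.mutate [CharZero K] {s : SeedData n m F} (hs : s.IsPreseed K) (i : Fin n) :
    (s.mutate i).IsPreseed K := by
  refine ⟨?_, isExchangeMatrix_mutate hs.2 i⟩
  rw [vars_mutate]
  exact algebraicIndependent_exchangeAt hs.1 (hs.2.diag i)

lemma IsPreseed.vars_ne_zero [CharZero K] {s : SeedData n m F} (hs : s.IsPreseed K)
    (k : Fin n ⊕ Fin m) : s.vars k ≠ 0 := by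
  have : Nontrivial K := ⟨1, 0, one_ne_zero⟩
  exact hs.1.ne_zero k

lemma IsPreseed.exchange_ne_zero [CharZero K] {s : SeedData n m F} (hs : s.IsPreseed K)
    (i : Fin n) : s.exchange i ≠ 0 := exchangeBinomial_ne_zero hs.1 _

lemma exchange_mutate_self {s : SeedData n m F} (hs : IsExchangeMatrix s.B) (i : Fin n) :
    (s.mutate i).exchange i = s.exchange i := by
  rw [exchange_eq, exchange_eq, vars_mutate]
  have : (fun k => (s.mutate i).B k i) = fun k => -s.B k i := by
    funext k
    rw [mutate_B, if_pos (Or.inr rfl)]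
  rw [this, exchangeBinomial_neg]
  exact exchangeBinomial_update s.vars (β := fun k => s.B k i) (hs.diag i) _

lemma IsPreseed.mutate_mutate [CharZero K] {s : SeedData n m F} (hs : s.IsPreseed K) (i : Fin n) :
    (s.mutate i).mutate i = s := by
  have hB : ((s.mutate i).mutate i).B = s.B := by
    funext j k
    rw [mutate_B]
    split_ifs with h
    · rw [mutate_B, if_pos h, neg_neg]
    · rw [mutate_B s i j k, if_neg h, mutate_B s i j i, mutate_B s i (Sum.inl i) k,
        if_pos (Or.inr rfl), if_pos (Or.inl rfl), mul_div_two_neg]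
      ring
  have hx : ((s.mutate i).mutate i).x = s.x := by
    have h1 : (s.mutate i).x i = (s.x i)⁻¹ * s.exchange i := Function.update_self ..
    show Function.update (Function.update s.x i _) i
      (((s.mutate i).x i)⁻¹ * (s.mutate i).exchange i) = s.x
    rw [exchange_mutate_self hs.2, h1, Function.update_idem, mul_inv, inv_inv, mul_assoc,
      inv_mul_cancel₀ (hs.exchange_ne_zero i), mul_one, Function.update_eq_self]
  have hy : ((s.mutate i).mutate i).y = s.y := rfl
  cases h1 : (s.mutate i).mutate i
  cases s
  simp_all

lemma MutEquiv.isPreseed [CharZero K] {s t : SeedData n m F} (h : s.MutEquiv t)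
    (hs : s.IsPreseed K) : t.IsPreseed K := by
  induction h with
  | refl => exact hs
  | tail _ h ih =>
    obtain ⟨i, rfl⟩ := h
    exact ih.mutate i

lemma MutEquiv.symm [CharZero K] {s t : SeedData n m F} (h : s.MutEquiv t)
    (hs : s.IsPreseed K) : t.MutEquiv s := by
  induction h with
  | refl => exact Relation.ReflTransGen.refl
  | @tail b c hb h ih =>
    obtain ⟨i, rfl⟩ := h
    exact Relation.ReflTransGen.head ⟨i, ((MutEquiv.isPreseed hb hs).mutate_mutate i).symm⟩ ih

lemma isIsolated_mutate {s : SeedData n m F} {i k : Fin n}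
    (h : s.IsIsolated k) : (s.mutate i).IsIsolated k := by
  intro j
  rw [mutate_B, h j, h (Sum.inl i)]
  simp

lemma IsPreseed.isIsolated_mutate_iff [CharZero K] {s : SeedData n m F} (hs : s.IsPreseed K)
    {i k : Fin n} : (s.mutate i).IsIsolated k ↔ s.IsIsolated k := by
  refine ⟨fun h => ?_, isIsolated_mutate⟩
  have h1 : ((s.mutate i).mutate i).IsIsolated k := isIsolated_mutate h
  rwa [hs.mutate_mutate] at h1

lemma MutEquiv.isIsolated_iff [CharZero K] {s t : SeedData n m F} (h : s.MutEquiv t)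
    (hs : s.IsPreseed K) {k : Fin n} : t.IsIsolated k ↔ s.IsIsolated k := by
  induction h with
  | refl => rfl
  | tail hb h ih =>
    obtain ⟨i, rfl⟩ := h
    rw [← ih, (MutEquiv.isPreseed hb hs).isIsolated_mutate_iff]

lemma laurent_eq (s : SeedData n m F) : s.laurent K = laurentAlg K s.vars := rfl

/-- Mutation is multiplication by invertible matrices on both sides. The vector `w` is the image of
`v` under the column operation, and `B w = 0` once row `i` has been used. -/
lemma HasFullRank.mutate {s : SeedData n m F} (hs : s.HasFullRank) (hB : IsExchangeMatrix s.B)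
    (i : Fin n) : (s.mutate i).HasFullRank := by
  intro v hv
  set w : Fin n → ℤ := Function.update v i (∑ k, max (-s.B (Sum.inl i) k) 0 * v k - v i) with hw
  have hBi : ∑ k, s.B (Sum.inl i) k * v k = 0 := by
    have h1 := hv (Sum.inl i)
    simp only [mutate_B, true_or, if_true, neg_mul, Finset.sum_neg_distrib] at h1
    linarith
  have hsum : ∀ j, ∑ k, s.B j k * w k = ∑ k, s.B j k * v k +
      s.B j i * (∑ k, max (-s.B (Sum.inl i) k) 0 * v k - 2 * v i) := by
    intro j
    have h1 : ∀ k, s.B j k * w k = s.B j k * v k +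
        if k = i then s.B j i * (∑ k, max (-s.B (Sum.inl i) k) 0 * v k - 2 * v i) else 0 := by
      intro k
      by_cases hk : k = i
      · subst hk
        rw [if_pos rfl, hw, Function.update_self]; ring
      · rw [if_neg hk, hw, Function.update_of_ne hk, add_zero]
    simp only [h1, Finset.sum_add_distrib, Finset.sum_ite_eq', Finset.mem_univ, if_true]
  have hw0 : w = 0 := by
    apply hs
    intro j
    rw [hsum]
    by_cases hj : j = Sum.inl i
    · subst hj
      rw [hBi, hB.diag i]; ring
    · have h1 := hv j
      have h2 : ∀ k, (s.mutate i).B j k * v k = s.B j k * v k +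
          max (s.B j i) 0 * (s.B (Sum.inl i) k * v k) +
          s.B j i * (max (-s.B (Sum.inl i) k) 0 * v k) +
          if k = i then -2 * s.B j i * v i else 0 := by
        intro k
        rw [mutate_B]
        by_cases hk : k = i
        · subst hk
          rw [if_pos (Or.inr rfl), if_pos rfl, hB.diag k]
          simp; ring
        · rw [if_neg (by tauto), if_neg hk, mul_div_two_eq]; ring
      simp only [h2, Finset.sum_add_distrib, ← Finset.mul_sum, Finset.sum_ite_eq', Finset.mem_univ,
        if_true, hBi] at h1
      linarith
  have hvk : ∀ k, k ≠ i → v k = 0 := by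
    intro k hk
    have := congrFun hw0 k
    rwa [hw, Function.update_of_ne hk] at this
  funext k
  by_cases hk : k = i
  · subst hk
    have h1 := congrFun hw0 k
    rw [hw, Function.update_self, Finset.sum_eq_zero, zero_sub] at h1
    · simpa using h1
    · intro l _
      by_cases hl : l = k
      · subst hl; rw [hB.diag]; simp
      · rw [hvk l hl, mul_zero]
  · exact hvk k hk

lemma IsPreseed.neg {s : SeedData n m F} (hs : s.IsPreseed K) : s.neg.IsPreseed K := by
  refine ⟨hs.1, ?_⟩
  obtain ⟨d, hd, h⟩ := hs.2
  refine ⟨d, hd, fun i j => ?_⟩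
  have := h i j
  simp only [SeedData.neg, Matrix.neg_apply]
  linarith

lemma IsPreseed.mem_laurent_mutate_of_pos [CharZero K] {s : SeedData n m F} (hs : s.IsPreseed K)
    {j k : Fin n} (hjk : j ≠ k) (hpos : 0 < s.B (Sum.inl k) j) {z : F} (hz : z ∈ s.laurent K)
    (hzk : z ∈ (s.mutate k).laurent K) (hzj : z ∈ (s.mutate j).laurent K) :
    z ∈ ((s.mutate k).mutate j).laurent K := by
  rw [laurent_eq] at *
  rw [vars_mutate] at hzk hzj ⊢
  rw [vars_mutate]
  have hneg := (hs.2.pos_iff k j).1 hpos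
  obtain ⟨c, hc⟩ := Int.eq_ofNat_of_zero_le hpos.le
  obtain ⟨b, hb⟩ : ∃ b : ℕ, s.B (Sum.inl j) k = -(b + 1 : ℕ) :=
    ⟨(-s.B (Sum.inl j) k - 1).toNat, by omega⟩
  refine mem_laurentAlg_exchange_of_pos hs.1 (by simpa using hjk) (hs.2.diag j) hc hb
    (hs.2.diag k) ((hs.mutate k).2.diag j) ?_ ?_ hz hzk hzj
  · rw [mutate_B, if_pos (Or.inl rfl), hc]
  · intro i hi
    rw [mutate_B, if_neg (by tauto), mul_div_two_of_nonneg hpos.le, hc]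

/-- The sign of `b_{kj}` decides. Negative values reduce to positive ones by replacing `B` with
`-B`, which commutes with mutation; full rank is needed only when `b_{kj} = 0`, to separate the two
exchange binomials. -/
lemma IsPreseed.mem_laurent_mutate_mutate [CharZero K] {s : SeedData n m F} (hs : s.IsPreseed K)
    (hr : s.HasFullRank) {j k : Fin n} (hjk : j ≠ k) {z : F} (hz : z ∈ s.laurent K)
    (hzk : z ∈ (s.mutate k).laurent K) (hzj : z ∈ (s.mutate j).laurent K) :
    z ∈ ((s.mutate k).mutate j).laurent K := by
  rcases lt_trichotomy (s.B (Sum.inl k) j) 0 with h | h | h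
  · have h1 := hs.neg.mem_laurent_mutate_of_pos hjk (z := z)
      (by simpa [SeedData.neg] using h) hz (by rwa [mutate_neg]) (by rwa [mutate_neg])
    rwa [mutate_neg, mutate_neg] at h1
  · have h' := (hs.2.eq_zero_iff k j).1 h
    obtain ⟨ℓ, hℓj, hℓk⟩ := hr.exists_addMonoidHom hjk
    have hcol : (fun i => (s.mutate k).B i j) = fun i => s.B i j := by
      funext i
      rw [mutate_B, h]
      by_cases hi : i = Sum.inl k
      · subst hi; simp [h]
      · simp [hi, hjk]
    rw [laurent_eq] at *
    rw [vars_mutate] at hzk hzj ⊢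
    rw [vars_mutate, hcol]
    exact mem_laurentAlg_exchange_of_commute hs.1 (by simpa using hjk) (hs.2.diag j) h h'
      (hs.2.diag k) hℓj hℓk hzk hzj
  · exact hs.mem_laurent_mutate_of_pos hjk h hz hzk hzj

/-- Membership in the upper bound passes to every mutation-equivalent seed of full rank. -/
lemma MutEquiv.mem_laurent_of_hasFullRank [CharZero K] {s t : SeedData n m F} (h : s.MutEquiv t)
    (hs : s.IsPreseed K) (hr : s.HasFullRank) {z : F} (hz : z ∈ s.laurent K)
    (hzi : ∀ i, z ∈ (s.mutate i).laurent K) : z ∈ t.laurent K := by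
  have key : t.IsPreseed K ∧ t.HasFullRank ∧ z ∈ t.laurent K ∧
      ∀ i, z ∈ (t.mutate i).laurent K := by
    induction h with
    | refl => exact ⟨hs, hr, hz, hzi⟩
    | tail _ h ih =>
      obtain ⟨k, rfl⟩ := h
      obtain ⟨h1, h2, h3, h4⟩ := ih
      refine ⟨h1.mutate k, h2.mutate h1.2 k, h4 k, fun j => ?_⟩
      by_cases hjk : j = k
      · subst hjk
        rwa [h1.mutate_mutate]
      · exact h1.mem_laurent_mutate_mutate h2 hjk h3 (h4 k) (h4 j)
  exact key.2.2.1

/-- For `i = j` this is `x_i = f_i / x_i'`, where `f_i` does not involve `x_i'`. -/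
lemma IsPreseed.x_mem_laurent_mutate [CharZero K] {s : SeedData n m F} (hs : s.IsPreseed K)
    (i j : Fin n) : s.x i ∈ (s.mutate j).laurent K := by
  rw [laurent_eq]
  have h1 : ∀ k, k ≠ Sum.inl j → s.vars k = (s.mutate j).vars k := fun k hk => by
    rw [vars_mutate, exchangeAt_of_ne _ hk]
  by_cases hij : i = j
  · subst hij
    have h2 : s.x i = (s.mutate i).exchange i * ((s.mutate i).vars (Sum.inl i))⁻¹ := by
      rw [exchange_mutate_self hs.2, vars_mutate, exchangeAt_self, ← exchange_eq]
      have := hs.exchange_ne_zero i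
      have := hs.vars_ne_zero (Sum.inl i)
      field_simp
      rfl
    rw [h2]
    exact mul_mem (laurentRest_le _ _ (exchangeBinomial_mem_rest _ ((hs.mutate i).2.diag i)))
      (inv_mem_laurentAlg _ _)
  · rw [show s.x i = s.vars (Sum.inl i) from rfl, h1 _ (by simpa using hij)]
    exact mem_laurentAlg _ _

lemma MutEquiv.x_mem_laurent_of_hasFullRank [CharZero K] {s t : SeedData n m F}
    (h : s.MutEquiv t) (hs : s.IsPreseed K) (hr : s.HasFullRank) (i : Fin n) :
    s.x i ∈ t.laurent K :=
  h.mem_laurent_of_hasFullRank hs hr (mem_laurentAlg s.vars (Sum.inl i))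
    (hs.x_mem_laurent_mutate i)

end SeedData

/-! ### Specialization of power series at the origin. -/

section PowerSeries

variable (σ : Type*) (F : Type v) [Field F]

/-- The shift of variables is an automorphism of the polynomial ring, which embeds into power
series. -/
lemma algebraicIndependent_one_add_X :
    AlgebraicIndependent F (fun q : σ => (1 + MvPowerSeries.X q : MvPowerSeries σ F)) := by
  have h1 : AlgebraicIndependent F (fun q : σ => (1 + MvPolynomial.X q : MvPolynomial σ F)) := by
    rw [algebraicIndependent_iff_injective_aeval]
    refine Function.LeftInverse.injective
      (g := MvPolynomial.aeval fun q : σ => (MvPolynomial.X q - 1 : MvPolynomial σ F)) fun p => ?_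
    rw [← AlgHom.comp_apply]
    have : (MvPolynomial.aeval fun q : σ => (MvPolynomial.X q - 1 : MvPolynomial σ F)).comp
        (MvPolynomial.aeval fun q : σ => (1 + MvPolynomial.X q : MvPolynomial σ F)) =
        AlgHom.id F _ := by
      ext q
      simp
    rw [this, AlgHom.id_apply]
  have h2 := h1.map' (f := MvPolynomial.coeToMvPowerSeries.algHom F) (by
    intro p q h
    simpa using h)
  convert h2 using 1
  funext q
  simp

variable {σ F}

/-- The element `z` of the fraction field of a power series ring is a power series with constant
coefficient `c`. -/
def SpecializesTo (z : FractionRing (MvPowerSeries σ F)) (c : F) : Prop :=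
  ∃ r : MvPowerSeries σ F, algebraMap _ _ r = z ∧ MvPowerSeries.constantCoeff r = c

namespace SpecializesTo

variable {z w : FractionRing (MvPowerSeries σ F)} {c d : F}

lemma algebraMap (r : MvPowerSeries σ F) :
    SpecializesTo (algebraMap _ (FractionRing (MvPowerSeries σ F)) r)
      (MvPowerSeries.constantCoeff r) := ⟨r, rfl, rfl⟩

lemma add (hz : SpecializesTo z c) (hw : SpecializesTo w d) : SpecializesTo (z + w) (c + d) := by
  obtain ⟨r, rfl, rfl⟩ := hz
  obtain ⟨s, rfl, rfl⟩ := hw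
  exact ⟨r + s, by simp, by simp⟩

lemma mul (hz : SpecializesTo z c) (hw : SpecializesTo w d) : SpecializesTo (z * w) (c * d) := by
  obtain ⟨r, rfl, rfl⟩ := hz
  obtain ⟨s, rfl, rfl⟩ := hw
  exact ⟨r * s, by simp, by simp⟩

lemma one : SpecializesTo (1 : FractionRing (MvPowerSeries σ F)) 1 := ⟨1, by simp, by simp⟩

lemma pow (hz : SpecializesTo z c) (k : ℕ) : SpecializesTo (z ^ k) (c ^ k) := by
  obtain ⟨r, rfl, rfl⟩ := hz
  exact ⟨r ^ k, by simp, by simp⟩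

lemma prod {ι : Type*} (s : Finset ι) {f : ι → FractionRing (MvPowerSeries σ F)} {g : ι → F}
    (h : ∀ i ∈ s, SpecializesTo (f i) (g i)) : SpecializesTo (∏ i ∈ s, f i) (∏ i ∈ s, g i) := by
  classical
  induction s using Finset.induction_on with
  | empty => simpa using one
  | insert a s ha ih =>
    rw [Finset.prod_insert ha, Finset.prod_insert ha]
    exact (h a (Finset.mem_insert_self a s)).mul
      (ih fun i hi => h i (Finset.mem_insert_of_mem hi))

lemma inv (hz : SpecializesTo z c) (hc : c ≠ 0) : SpecializesTo z⁻¹ c⁻¹ := by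
  obtain ⟨r, rfl, rfl⟩ := hz
  refine ⟨r⁻¹, ?_, MvPowerSeries.constantCoeff_inv r⟩
  apply eq_inv_of_mul_eq_one_left
  rw [← map_mul, MvPowerSeries.inv_mul_cancel r hc, map_one]

lemma unique (h : SpecializesTo z c) (h' : SpecializesTo z d) : c = d := by
  obtain ⟨r, hr, rfl⟩ := h
  obtain ⟨s, hs, rfl⟩ := h'
  rw [IsFractionRing.injective (MvPowerSeries σ F) _ (hr.trans hs.symm)]

end SpecializesTo

end PowerSeries

/-! ### Framed seeds and the Laurent phenomenon in general. -/

namespace SeedData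

variable {n m : ℕ} {F : Type v} [Field F]

/-- Add a frozen variable for every exchangeable index, with the identity matrix as exchange
matrix. -/
noncomputable def framed (s : SeedData n m F) :
    SeedData n (m + n) (FractionRing (MvPowerSeries (Fin n) F)) where
  x i := algebraMap F _ (s.x i)
  y := Fin.append (fun l => algebraMap F _ (s.y l))
    (fun q => algebraMap (MvPowerSeries (Fin n) F) _ (1 + MvPowerSeries.X q))
  B := fun k j => Sum.elim (fun i => s.B (Sum.inl i) j)
    (Fin.append (fun l => s.B (Sum.inr l) j) (fun q => if q = j then 1 else 0)) k

lemma framed_hasFullRank (s : SeedData n m F) : s.framed.HasFullRank := by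
  intro v hv
  funext i
  have := hv (Sum.inr (Fin.natAdd m i))
  simpa [framed] using this

/-- `T` lives over a power series ring, has `n` more frozen variables, and specializes to `t`. -/
structure SeedSpecializesTo (T : SeedData n (m + n) (FractionRing (MvPowerSeries (Fin n) F)))
    (t : SeedData n m F) : Prop where
  x : ∀ i, SpecializesTo (T.x i) (t.x i)
  y : ∀ l, SpecializesTo (T.y (Fin.castAdd n l)) (t.y l)
  y' : ∀ q, SpecializesTo (T.y (Fin.natAdd m q)) 1
  B : ∀ i j, T.B (Sum.inl i) j = t.B (Sum.inl i) j
  B' : ∀ l j, T.B (Sum.inr (Fin.castAdd n l)) j = t.B (Sum.inr l) j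

lemma framed_specializesTo (s : SeedData n m F) : SeedSpecializesTo s.framed s where
  x i := ⟨MvPowerSeries.C (s.x i), rfl, by simp⟩
  y l := ⟨MvPowerSeries.C (s.y l), by simp [framed]; rfl, by simp⟩
  y' q := ⟨1 + MvPowerSeries.X q, by simp [framed], by simp⟩
  B i j := rfl
  B' l j := by simp [framed]

lemma SeedSpecializesTo.exchange {T : SeedData n (m + n) (FractionRing (MvPowerSeries (Fin n) F))}
    {t : SeedData n m F} (h : SeedSpecializesTo T t) (i : Fin n) :
    SpecializesTo (T.exchange i) (t.exchange i) := by
  have key : ∀ (e : Fin n ⊕ Fin (m + n) → ℕ) (e' : Fin n ⊕ Fin m → ℕ),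
      (∀ k, e (Sum.inl k) = e' (Sum.inl k)) →
      (∀ l, e (Sum.inr (Fin.castAdd n l)) = e' (Sum.inr l)) →
      SpecializesTo (∏ k, T.vars k ^ e k) (∏ k, t.vars k ^ e' k) := by
    intro e e' h1 h2
    rw [Fintype.prod_sum_type, Fintype.prod_sum_type, Fin.prod_univ_add]
    refine SpecializesTo.mul (SpecializesTo.prod _ fun k _ => ?_) ?_
    · rw [h1]
      exact (h.x k).pow _
    · rw [← mul_one (∏ l, t.vars (Sum.inr l) ^ e' (Sum.inr l))]
      refine SpecializesTo.mul (SpecializesTo.prod _ fun l _ => ?_) ?_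
      · rw [h2]
        exact (h.y l).pow _
      · have h3 := SpecializesTo.prod Finset.univ
          (f := fun q => T.vars (Sum.inr (Fin.natAdd m q)) ^ e (Sum.inr (Fin.natAdd m q)))
          (fun q _ => (h.y' q).pow (e (Sum.inr (Fin.natAdd m q))))
        simpa using h3
  refine (key _ _ ?_ ?_).add (key _ _ ?_ ?_) <;> intro k <;> simp only [h.B, h.B']

/-- Division by `T.x i` stays within power series because its constant coefficient `t.x i` is
nonzero. -/
lemma SeedSpecializesTo.mutate {T : SeedData n (m + n) (FractionRing (MvPowerSeries (Fin n) F))}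
    {t : SeedData n m F} (h : SeedSpecializesTo T t) (i : Fin n) (hi : t.x i ≠ 0) :
    SeedSpecializesTo (T.mutate i) (t.mutate i) where
  x k := by
    show SpecializesTo (Function.update T.x i _ k) (Function.update t.x i _ k)
    by_cases hk : k = i
    · subst hk
      rw [Function.update_self, Function.update_self]
      exact ((h.x k).inv hi).mul (h.exchange k)
    · rw [Function.update_of_ne hk, Function.update_of_ne hk]
      exact h.x k
  y := h.y
  y' := h.y'
  B k j := by simp only [mutate_B, h.B, Sum.inl.injEq]
  B' l j := by simp only [mutate_B, h.B, h.B', reduceCtorEq]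

variable {K : Type u} [CommRing K] [Algebra K F]

/-- Independence is transitive in the tower: the old variables over `K`, the new ones over `F`.
Generation of the ambient field is not part of `IsPreseed`, so the large fraction field is harmless.
-/
lemma IsPreseed.framed {s : SeedData n m F} (hs : s.IsPreseed K) : s.framed.IsPreseed K := by
  refine ⟨?_, hs.2⟩
  have h1 : AlgebraicIndependent F (fun q : Fin n =>
      algebraMap (MvPowerSeries (Fin n) F) (FractionRing (MvPowerSeries (Fin n) F))
        (1 + MvPowerSeries.X q)) :=
    (algebraicIndependent_one_add_X (Fin n) F).map'
      (f := IsScalarTower.toAlgHom F _ (FractionRing (MvPowerSeries (Fin n) F)))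
      (IsFractionRing.injective (MvPowerSeries (Fin n) F) _)
  have h2 := AlgebraicIndependent.sumElim_comp hs.1 h1
  let e : Fin n ⊕ Fin (m + n) ≃ Fin n ⊕ (Fin n ⊕ Fin m) :=
    ((Equiv.sumCongr (Equiv.refl _) finSumFinEquiv.symm).trans
      (Equiv.sumAssoc _ _ _).symm).trans (Equiv.sumComm _ _)
  have h3 := h2.comp e e.injective
  have hvars : s.framed.vars = Sum.elim (fun q : Fin n =>
      algebraMap (MvPowerSeries (Fin n) F) (FractionRing (MvPowerSeries (Fin n) F))
        (1 + MvPowerSeries.X q)) (algebraMap F _ ∘ s.vars) ∘ e := by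
    funext k
    rcases k with k | k
    · rfl
    induction k using Fin.addCases with
    | left l => simp [e, vars, SeedData.framed]
    | right q => simp [e, vars, SeedData.framed]
  rw [hvars]
  exact h3

lemma SeedSpecializesTo.exists_mem_laurent
    {T : SeedData n (m + n) (FractionRing (MvPowerSeries (Fin n) F))} {t : SeedData n m F}
    (h : SeedSpecializesTo T t) (ht : ∀ k, t.vars k ≠ 0)
    {z : FractionRing (MvPowerSeries (Fin n) F)} (hz : z ∈ T.laurent K) :
    ∃ c ∈ t.laurent K, SpecializesTo z c := by
  have hvars : ∀ k, ∃ c ∈ t.laurent K, c ≠ 0 ∧ c⁻¹ ∈ t.laurent K ∧ SpecializesTo (T.vars k) c := by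
    have h1 : ∀ k, t.vars k ∈ t.laurent K ∧ t.vars k ≠ 0 ∧ (t.vars k)⁻¹ ∈ t.laurent K :=
      fun k => ⟨mem_laurentAlg _ k, ht k, inv_mem_laurentAlg _ k⟩
    rintro (k | k)
    · obtain ⟨h2, h3, h4⟩ := h1 (Sum.inl k)
      exact ⟨_, h2, h3, h4, h.x k⟩
    · induction k using Fin.addCases with
      | left l =>
        obtain ⟨h2, h3, h4⟩ := h1 (Sum.inr l)
        exact ⟨_, h2, h3, h4, h.y l⟩
      | right q => exact ⟨1, one_mem _, one_ne_zero, by simp, h.y' q⟩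
  change z ∈ Algebra.adjoin K _ at hz
  induction hz using Algebra.adjoin_induction with
  | mem x hx =>
    obtain ⟨k, rfl⟩ | ⟨k, rfl⟩ := hx <;> obtain ⟨c, hc, hc0, hc', hs⟩ := hvars k
    · exact ⟨c, hc, hs⟩
    · exact ⟨c⁻¹, hc', hs.inv hc0⟩
  | algebraMap r =>
    refine ⟨algebraMap K F r, algebraMap_mem _ _, MvPowerSeries.C (algebraMap K F r), ?_, by simp⟩
    rw [IsScalarTower.algebraMap_apply K (MvPowerSeries (Fin n) F) (FractionRing _),
      MvPowerSeries.algebraMap_apply]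
  | add x y _ _ hx hy =>
    obtain ⟨c, hc, hs⟩ := hx
    obtain ⟨d, hd, hs'⟩ := hy
    exact ⟨_, add_mem hc hd, hs.add hs'⟩
  | mul x y _ _ hx hy =>
    obtain ⟨c, hc, hs⟩ := hx
    obtain ⟨d, hd, hs'⟩ := hy
    exact ⟨_, mul_mem hc hd, hs.mul hs'⟩

/-- The Laurent phenomenon. -/
theorem MutEquiv.x_mem_laurent [CharZero K] {s t : SeedData n m F} (h : s.MutEquiv t)
    (hs : s.IsPreseed K) (i : Fin n) : s.x i ∈ t.laurent K := by
  obtain ⟨T, hT, hTt⟩ : ∃ T, s.framed.MutEquiv T ∧ SeedSpecializesTo T t := by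
    induction h with
    | refl => exact ⟨_, Relation.ReflTransGen.refl, s.framed_specializesTo⟩
    | tail hb h ih =>
      obtain ⟨k, rfl⟩ := h
      obtain ⟨T, hT, hTb⟩ := ih
      exact ⟨T.mutate k, hT.tail ⟨k, rfl⟩,
        hTb.mutate k ((MutEquiv.isPreseed hb hs).vars_ne_zero (Sum.inl k))⟩
  obtain ⟨c, hc, hsc⟩ := hTt.exists_mem_laurent (h.isPreseed hs).vars_ne_zero
    (hT.x_mem_laurent_of_hasFullRank hs.framed s.framed_hasFullRank i)
  rwa [(s.framed_specializesTo.x i).unique hsc]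

end SeedData

/-! ### Divisors of monomials in the exchangeable variables. -/

lemma laurentMonomial_neg {ι : Type*} [Fintype ι] {F : Type*} [Field F] (v : ι → F) (α : ι → ℤ) :
    laurentMonomial v (-α) = (laurentMonomial v α)⁻¹ := by
  simp [laurentMonomial]

namespace SeedData

variable {n m : ℕ} {F : Type v} [Field F]

lemma monomial_eq_laurentMonomial (s : SeedData n m F) (a : Fin n → ℕ) :
    s.monomial a = laurentMonomial s.vars (Sum.elim (fun i => (a i : ℤ)) 0) := by
  rw [laurentMonomial, Fintype.prod_sum_type]
  simp [monomial, vars]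

lemma laurentMonomial_vars (s : SeedData n m F) {α : Fin n ⊕ Fin m → ℤ}
    (h : ∀ i, 0 ≤ α (Sum.inl i)) :
    laurentMonomial s.vars α = (∏ l, s.y l ^ α (Sum.inr l)) *
      s.monomial fun i => (α (Sum.inl i)).toNat := by
  rw [laurentMonomial, Fintype.prod_sum_type, mul_comm, monomial]
  congr 1
  refine Finset.prod_congr rfl fun i _ => ?_
  rw [← zpow_natCast, Int.toNat_of_nonneg (h i)]
  rfl

lemma monomial_add (s : SeedData n m F) (a b : Fin n → ℕ) :
    s.monomial (a + b) = s.monomial a * s.monomial b := by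
  simp [monomial, pow_add, Finset.prod_mul_distrib]

lemma monomial_pow (s : SeedData n m F) (a : Fin n → ℕ) (N : ℕ) :
    s.monomial a ^ N = s.monomial fun i => N * a i := by
  simp [monomial, ← Finset.prod_pow, ← pow_mul, mul_comm]

@[simp] lemma monomial_zero (s : SeedData n m F) : s.monomial 0 = 1 := by
  simp [monomial]

lemma MutEquiv.y_eq {s t : SeedData n m F} (h : s.MutEquiv t) : t.y = s.y := by
  induction h with
  | refl => rfl
  | tail _ h ih =>
    obtain ⟨i, rfl⟩ := h
    exact ih

variable {K : Type u} [CommRing K] [Algebra K F]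

/-- A negative power of `x_i` that is Laurent in the mutated seed would invert `f_i = x_i x_i'`
there, but `f_i` is not a unit. -/
lemma IsPreseed.exponent_nonneg [IsDomain K] [CharZero K] {s : SeedData n m F}
    (hs : s.IsPreseed K) {i : Fin n} (hi : ¬ s.IsIsolated i ∨ ¬ IsUnit (2 : K)) {c : K}
    (hc : IsUnit c) {α : Fin n ⊕ Fin m → ℤ}
    (h : algebraMap K F c * laurentMonomial s.vars α ∈ (s.mutate i).laurent K) :
    0 ≤ α (Sum.inl i) := by
  by_contra! hneg
  rw [laurent_eq] at h
  have hs' := hs.mutate i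
  obtain ⟨p, hp⟩ : ∃ p : ℕ, α (Sum.inl i) = -(p + 1 : ℕ) :=
    ⟨(-α (Sum.inl i) - 1).toNat, by omega⟩
  set w := (s.mutate i).vars with hw
  set f := (s.mutate i).exchange i with hf
  have hf0 : f ≠ 0 := hs'.exchange_ne_zero i
  have hwi : w (Sum.inl i) ≠ 0 := hs'.vars_ne_zero _
  have hxi : s.vars (Sum.inl i) ≠ 0 := hs.vars_ne_zero _
  have hxw : s.vars (Sum.inl i) * w (Sum.inl i) = f := by
    rw [hw, hf, exchange_mutate_self hs.2, vars_mutate, exchangeAt_self, ← exchange_eq]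
    field_simp
  have hrest : laurentRest K s.vars (Sum.inl i) ≤ laurentAlg K w := by
    rw [hw, vars_mutate, exchangeAt, ← laurentRest_update s.vars (Sum.inl i)]
    exact laurentRest_le _ _
  set β : Fin n ⊕ Fin m → ℤ := α - Pi.single (Sum.inl i) (α (Sum.inl i)) with hβ
  have hβi : (-β) (Sum.inl i) = 0 := by simp [hβ]
  have hβmem : (laurentMonomial s.vars β)⁻¹ ∈ laurentAlg K w := by
    rw [← laurentMonomial_neg]
    exact hrest (laurentMonomial_mem_rest s.vars hβi)
  obtain ⟨d, hd⟩ := hc.exists_right_inv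
  have hcd : algebraMap K F c * algebraMap K F d = 1 := by rw [← map_mul, hd, map_one]
  have hα : laurentMonomial s.vars α =
      (s.vars (Sum.inl i) ^ (p + 1))⁻¹ * laurentMonomial s.vars β := by
    have : α = Pi.single (Sum.inl i) (α (Sum.inl i)) + β := by simp [hβ]
    conv_lhs => rw [this, laurentMonomial_add hs.vars_ne_zero, laurentMonomial_single, hp,
      zpow_neg, zpow_natCast]
  have hβ0 := laurentMonomial_ne_zero hs.vars_ne_zero β
  have hfmem : f ∈ laurentAlg K w := laurentRest_le w (Sum.inl i)
    (exchangeBinomial_mem_rest _ ((hs.mutate i).2.diag i))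
  have hinv : f⁻¹ ∈ laurentAlg K w := by
    -- From `f = x_i x_i'`: `f⁻¹ = x_i ^ (-(p+1)) * x_i' ^ (-(p+1)) * f ^ p`, the first factor being
    -- the given element up to units.
    have h1 : f⁻¹ = algebraMap K F d * (algebraMap K F c * laurentMonomial s.vars α) *
        (laurentMonomial s.vars β)⁻¹ * (w (Sum.inl i))⁻¹ ^ (p + 1) * f ^ p := by
      rw [hα, ← mul_assoc (algebraMap K F d), mul_comm (algebraMap K F d), hcd, ← hxw, inv_pow, mul_pow]
      field_simp
      ring
    rw [h1]
    exact mul_mem (mul_mem (mul_mem (mul_mem (algebraMap_mem _ _) h) hβmem)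
      (pow_mem (inv_mem_laurentAlg w _) _)) (pow_mem hfmem _)
  have hne : (fun k => (((s.mutate i).B k i).toNat : ℤ)) ≠
      (fun k => ((-(s.mutate i).B k i).toNat : ℤ)) ∨ ¬ IsUnit (2 : K) := by
    refine hi.imp_left fun hi heq => hi ?_
    rw [← hs.isIsolated_mutate_iff (i := i)]
    intro k
    have h1 : (((s.mutate i).B k i).toNat : ℤ) = ((-(s.mutate i).B k i).toNat : ℤ) :=
      congrFun heq k
    omega
  refine binomial_mul_ne_one hs'.1 hs'.vars_ne_zero hne hinv ?_
  rw [← exchangeBinomial_eq]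
  exact mul_inv_cancel₀ hf0

variable (K) in
/-- The products of a unit of `K`, a Laurent monomial in the frozen variables and a monomial in
the exchangeable variables `x_i` with `e_i ≠ 0`. -/
def unitMonomials (s : SeedData n m F) (e : Fin n → ℕ) : Set F :=
  {z | ∃ c : K, IsUnit c ∧ ∃ (b : Fin m → ℤ) (a : Fin n → ℕ), (∀ i, e i = 0 → a i = 0) ∧
    z = algebraMap K F c * (∏ l, s.y l ^ b l) * s.monomial a}

variable (K) in
/-- A subalgebra that contains the variables of `s` and the inverses of the frozen ones, and lies in
the upper bound of `s`. -/
structure IsIntermediate (s : SeedData n m F) (R : Subalgebra K F) : Prop where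
  x_mem : ∀ i, s.x i ∈ R
  y_mem : ∀ l, s.y l ∈ R
  y_inv_mem : ∀ l, (s.y l)⁻¹ ∈ R
  le_laurent : R ≤ s.laurent K
  le_laurent_mutate : ∀ i, R ≤ (s.mutate i).laurent K

section Divisors

variable {s : SeedData n m F} {R : Subalgebra K F}

lemma IsIntermediate.monomial_mem (hR : s.IsIntermediate K R) (a : Fin n → ℕ) : s.monomial a ∈ R :=
  prod_mem fun i _ => pow_mem (hR.x_mem i) _

lemma IsIntermediate.prod_zpow_mem (hR : s.IsIntermediate K R) (b : Fin m → ℤ) :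
    ∏ l, s.y l ^ b l ∈ R := by
  refine prod_mem fun l _ => ?_
  obtain ⟨k, hk | hk⟩ := (b l).eq_nat_or_neg
  · simpa [hk] using pow_mem (hR.y_mem l) k
  · simpa [hk] using pow_mem (hR.y_inv_mem l) k

lemma IsPreseed.mul_frozen_eq_one [CharZero K] (hs : s.IsPreseed K) {c d : K} (hcd : c * d = 1)
    (b : Fin m → ℤ) : algebraMap K F c * (∏ l, s.y l ^ b l) *
      (algebraMap K F d * (∏ l, s.y l ^ (-b l))) = 1 := by
  rw [mul_mul_mul_comm, ← map_mul, hcd, map_one, one_mul, ← Finset.prod_mul_distrib]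
  refine Finset.prod_eq_one fun l _ => ?_
  rw [zpow_neg]
  exact mul_inv_cancel₀ (zpow_ne_zero _ (hs.vars_ne_zero (Sum.inr l)))

lemma IsPreseed.exponent_eq [IsDomain K] [CharZero K] (hs : s.IsPreseed K) {c : K} (hc : c ≠ 0)
    {α : Fin n ⊕ Fin m → ℤ} {a : Fin n → ℕ}
    (h : algebraMap K F c * laurentMonomial s.vars α = s.monomial a) (i : Fin n) :
    α (Sum.inl i) = a i := by
  have h1 : algebraMap K F c * laurentMonomial s.vars α =
      algebraMap K F 1 * laurentMonomial s.vars (Sum.elim (fun i => (a i : ℤ)) 0) := by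
    rw [h, map_one, one_mul, monomial_eq_laurentMonomial]
  rw [laurentMonomial_exponent_unique hs.1 hs.vars_ne_zero hc h1]
  rfl

variable [IsDomain K] [CharZero K]

/-- Both factors are Laurent monomials up to units of `K`, with nonnegative exponents at the
exchangeable variables; these add up to `E`, which bounds each of them. -/
lemma IsIntermediate.exists_of_mul_eq_monomial (hR : s.IsIntermediate K R) (hs : s.IsPreseed K)
    (hi : ∀ i, ¬ s.IsIsolated i ∨ ¬ IsUnit (2 : K)) {z w : F} (hz : z ∈ R) (hw : w ∈ R)
    {E : Fin n → ℕ} (h : z * w = s.monomial E) :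
    ∃ c : K, IsUnit c ∧ ∃ (b : Fin m → ℤ) (a : Fin n → ℕ), (∀ i, a i ≤ E i) ∧
      z = algebraMap K F c * (∏ l, s.y l ^ b l) * s.monomial a := by
  have hE0 : s.monomial E ≠ 0 := by
    rw [monomial_eq_laurentMonomial]
    exact laurentMonomial_ne_zero hs.vars_ne_zero _
  have hEinv : (s.monomial E)⁻¹ ∈ s.laurent K := by
    rw [monomial_eq_laurentMonomial, ← laurentMonomial_neg]
    exact laurentMonomial_mem _ _
  have key : ∀ z w, z ∈ R → w ∈ R → z * w = s.monomial E →
      ∃ (c : K) (α : Fin n ⊕ Fin m → ℤ), IsUnit c ∧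
        z = algebraMap K F c * laurentMonomial s.vars α ∧ ∀ i, 0 ≤ α (Sum.inl i) := by
    intro z w hz hw h
    obtain ⟨c, α, hc, rfl⟩ := exists_eq_laurentMonomial_of_mul_eq_one hs.1 hs.vars_ne_zero
      (hR.le_laurent hz) (mul_mem (hR.le_laurent hw) hEinv)
      (by rw [← mul_assoc, h, mul_inv_cancel₀ hE0])
    exact ⟨c, α, hc, rfl, fun i => hs.exponent_nonneg (hi i) hc (hR.le_laurent_mutate i hz)⟩
  obtain ⟨c, α, hc, rfl, hα⟩ := key z w hz hw h
  obtain ⟨d, β, hd, rfl, hβ⟩ := key w _ hw hz (by rw [mul_comm, h])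
  have hsum : algebraMap K F (c * d) * laurentMonomial s.vars (α + β) = s.monomial E := by
    rw [← h, map_mul, laurentMonomial_add hs.vars_ne_zero]; ring
  have hexp := hs.exponent_eq (mul_ne_zero hc.ne_zero hd.ne_zero) hsum
  refine ⟨c, hc, fun l => α (Sum.inr l), fun i => (α (Sum.inl i)).toNat, fun i => ?_, ?_⟩
  · have h1 := hexp i
    have h2 := hβ i
    rw [Pi.add_apply] at h1
    show (α (Sum.inl i)).toNat ≤ E i
    omega
  · rw [laurentMonomial_vars s hα, mul_assoc]

lemma IsIntermediate.coe_map_divisorClosure (hR : s.IsIntermediate K R) (hs : s.IsPreseed K)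
    (hi : ∀ i, ¬ s.IsIsolated i ∨ ¬ IsUnit (2 : K)) {e : Fin n → ℕ} (he : s.monomial e ∈ R) :
    ((divisorClosure {(⟨s.monomial e, he⟩ : R)}).map R.val : Set F) = s.unitMonomials K e := by
  ext z
  constructor
  · rintro ⟨⟨z, hz⟩, ⟨u, hu, ⟨w, hw⟩, hzw⟩, rfl⟩
    obtain ⟨N, rfl⟩ := Submonoid.mem_closure_singleton.1 hu
    have h1 : z * w = s.monomial fun i => N * e i := by
      rw [← monomial_pow]
      exact (congrArg Subtype.val hzw).symm
    obtain ⟨c, hc, b, a, ha, hz'⟩ := hR.exists_of_mul_eq_monomial hs hi hz hw h1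
    exact ⟨c, hc, b, a, fun i hi => by simpa [hi] using ha i, hz'⟩
  · rintro ⟨c, hc, b, a, ha, rfl⟩
    obtain ⟨d, hd⟩ := hc.exists_right_inv
    have hz : algebraMap K F c * (∏ l, s.y l ^ b l) * s.monomial a ∈ R :=
      mul_mem (mul_mem (algebraMap_mem _ _) (hR.prod_zpow_mem b)) (hR.monomial_mem a)
    -- Large enough that `a i ≤ N * e i` wherever `e i ≥ 1`.
    set N := ∑ i, a i with hN
    have hle : ∀ i, a i ≤ N * e i := by
      intro i
      obtain h0 | h0 := Nat.eq_zero_or_pos (e i)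
      · rw [ha i h0]; exact Nat.zero_le _
      · exact (Finset.single_le_sum (fun _ _ => Nat.zero_le _) (Finset.mem_univ i)).trans
          (Nat.le_mul_of_pos_right N h0)
    have hw : algebraMap K F d * (∏ l, s.y l ^ (-b l)) * s.monomial (fun i => N * e i - a i) ∈ R :=
      mul_mem (mul_mem (algebraMap_mem _ _) (hR.prod_zpow_mem _)) (hR.monomial_mem _)
    have hcl : (⟨s.monomial e, he⟩ : R) ^ N ∈
        Submonoid.closure {(⟨s.monomial e, he⟩ : R)} :=
      pow_mem (Submonoid.subset_closure (Set.mem_singleton _)) N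
    have hx : s.monomial a * s.monomial (fun i => N * e i - a i) = s.monomial e ^ N := by
      rw [← monomial_add, monomial_pow]
      congr 1
      funext i
      exact Nat.add_sub_cancel' (hle i)
    have hdvd : (⟨s.monomial e, he⟩ : R) ^ N = ⟨_, hz⟩ * ⟨_, hw⟩ := by
      apply Subtype.ext
      show s.monomial e ^ N = algebraMap K F c * (∏ l, s.y l ^ b l) * s.monomial a *
        (algebraMap K F d * (∏ l, s.y l ^ (-b l)) * s.monomial (fun i => N * e i - a i))
      rw [mul_mul_mul_comm, hs.mul_frozen_eq_one hd b, one_mul, hx]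
    exact ⟨⟨_, hz⟩, ⟨_, hcl, ⟨_, hw⟩, hdvd⟩, rfl⟩

lemma IsIntermediate.unitMonomials_eq (hR : s.IsIntermediate K R) (hs : s.IsPreseed K)
    (hi : ∀ i, ¬ s.IsIsolated i ∨ ¬ IsUnit (2 : K)) (e : Fin n → ℕ) :
    s.unitMonomials K e = {z | ∃ (ε : Rˣ) (a : Fin n → ℕ), (∀ i, e i = 0 → a i = 0) ∧
      z = ((ε : R) : F) * s.monomial a} := by
  ext z
  constructor
  · rintro ⟨c, hc, b, a, ha, rfl⟩
    obtain ⟨d, hd⟩ := hc.exists_right_inv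
    let ε : R := ⟨_, mul_mem (algebraMap_mem R c) (hR.prod_zpow_mem b)⟩
    let η : R := ⟨_, mul_mem (algebraMap_mem R d) (hR.prod_zpow_mem fun l => -b l)⟩
    have h1 : ε * η = 1 := Subtype.ext (hs.mul_frozen_eq_one hd b)
    exact ⟨Units.mkOfMulEqOne ε η h1, a, ha, rfl⟩
  · rintro ⟨ε, a, ha, rfl⟩
    -- A unit is a divisor of the empty monomial, so its exchangeable exponents vanish.
    obtain ⟨c, hc, b, a', ha', h⟩ := hR.exists_of_mul_eq_monomial hs hi (ε : R).2 (ε⁻¹ : Rˣ).1.2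
      (E := 0) (by rw [monomial_zero]; exact congrArg Subtype.val ε.mul_inv)
    have h0 : a' = 0 := funext fun i => Nat.le_zero.1 (ha' i)
    refine ⟨c, hc, b, a, ha, ?_⟩
    rw [h, h0, monomial_zero, mul_one]

/-- Divisibility inside the monoid compares exponents. Applied in both directions, it shows that
associated monomials are equal without first identifying the units. -/
lemma IsPreseed.le_of_mul_eq_monomial (hs : s.IsPreseed K) {e a a' : Fin n → ℕ} {w : F}
    (hw : w ∈ s.unitMonomials K e) (h : s.monomial a * w = s.monomial a') : a ≤ a' := by
  obtain ⟨c, hc, b, g, -, rfl⟩ := hw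
  have h1 : algebraMap K F c * laurentMonomial s.vars (Sum.elim (fun i => ((a i + g i : ℕ) : ℤ)) b) =
      s.monomial a' := by
    rw [← h, laurentMonomial_vars s (fun i => Int.natCast_nonneg _)]
    have : (fun i => (Sum.elim (fun i => ((a i + g i : ℕ) : ℤ)) b (Sum.inl i : Fin n ⊕ Fin m)).toNat)
        = a + g := by
      funext i
      simp only [Sum.elim_inl, Int.toNat_natCast, Pi.add_apply]
    rw [this, monomial_add]
    simp only [Sum.elim_inr]
    ring
  intro i
  have h2 := hs.exponent_eq hc.ne_zero h1 i
  rw [Sum.elim_inl] at h2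
  have h3 : a i + g i = a' i := by exact_mod_cast h2
  exact h3 ▸ Nat.le_add_right _ _

lemma IsPreseed.exists_isFreeAbelianOn (hs : s.IsPreseed K) {e : Fin n → ℕ} {D : Submonoid F}
    (hD : (D : Set F) = s.unitMonomials K e) :
    ∃ b : {i : Fin n // e i ≠ 0} → D, (∀ i, (b i : F) = s.x i) ∧
      IsFreeAbelianOn (fun i => Associates.mk (b i)) := by
  classical
  have hmemD : ∀ z, z ∈ D ↔ z ∈ s.unitMonomials K e := fun z => by rw [← hD]; rfl
  have hx : ∀ i : {i : Fin n // e i ≠ 0}, s.x i ∈ D := fun i => by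
    rw [hmemD]
    refine ⟨1, isUnit_one, 0, Pi.single i.1 1, fun j hj => ?_, ?_⟩
    · rw [Pi.single_eq_of_ne]
      rintro rfl
      exact i.2 hj
    · rw [monomial, Finset.prod_eq_single i.1]
      · simp
      · intro j _ hj; simp [hj]
      · simp
  refine ⟨fun i => ⟨s.x i, hx i⟩, fun _ => rfl, ?_⟩
  -- Extension by zero to the indices with `e i = 0`, where elements of `D` have exponent zero
  -- anyway.
  let extend : ({i : Fin n // e i ≠ 0} →₀ ℕ) → Fin n → ℕ := fun a i =>
    if h : e i ≠ 0 then a ⟨i, h⟩ else 0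
  let prodD : ({i : Fin n // e i ≠ 0} →₀ ℕ) → D := fun a =>
    a.prod fun i k => (⟨s.x i, hx i⟩ : D) ^ k
  have hcoe : ∀ a, (prodD a : F) = s.monomial (extend a) := by
    intro a
    have h1 : (prodD a : F) = ∏ i : {i : Fin n // e i ≠ 0}, s.x i ^ extend a i := by
      rw [show (prodD a : F) = D.subtype (prodD a) from rfl]
      simp only [prodD]
      rw [Finsupp.prod_fintype _ _ (fun _ => pow_zero _), map_prod]
      refine Finset.prod_congr rfl fun i _ => ?_
      simp [extend, i.2]
    rw [h1, monomial, ← Finset.prod_subtype (Finset.univ.filter fun i => e i ≠ 0) (by simp)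
      (fun i => s.x i ^ extend a i), Finset.prod_filter_of_ne]
    intro i _ hne h0
    exact hne (by simp [extend, h0])
  have hmk : ∀ a : {i : Fin n // e i ≠ 0} →₀ ℕ,
      (a.prod fun i k => Associates.mk (⟨s.x i, hx i⟩ : D) ^ k) = Associates.mk (prodD a) := by
    intro a
    rw [← Associates.mkMonoidHom_apply, map_finsuppProd]
    refine Finsupp.prod_congr fun i _ => ?_
    rw [map_pow]
    rfl
  have hle : ∀ a a', Associated (prodD a) (prodD a') → extend a ≤ extend a' := by
    rintro a a' ⟨w, hw⟩
    refine hs.le_of_mul_eq_monomial ((hmemD _).1 (w : D).2) ?_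
    rw [← hcoe, ← hcoe]
    exact congrArg Subtype.val hw
  constructor
  · intro a a' haa
    simp only [hmk, Associates.mk_eq_mk_iff_associated] at haa
    have h1 := le_antisymm (hle _ _ haa) (hle _ _ haa.symm)
    ext i
    have h2 := congrFun h1 i.1
    simpa [extend, i.2] using h2
  · intro q
    obtain ⟨⟨z, hz⟩, rfl⟩ := Associates.mk_surjective q
    obtain ⟨c, hc, b, a, ha, rfl⟩ := (hmemD z).1 hz
    refine ⟨Finsupp.equivFunOnFinite.symm fun i => a i, ?_⟩
    have hext : extend (Finsupp.equivFunOnFinite.symm fun i => a i) = a := by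
      funext i
      by_cases h : e i = 0
      · simp [extend, h, ha i h]
      · simp [extend, h]
    simp only [hmk]
    rw [Associates.mk_eq_mk_iff_associated]
    obtain ⟨d, hd⟩ := hc.exists_right_inv
    have hε : algebraMap K F c * (∏ l, s.y l ^ b l) ∈ D :=
      (hmemD _).2 ⟨c, hc, b, 0, fun _ _ => rfl, by simp⟩
    have hη : algebraMap K F d * (∏ l, s.y l ^ (-b l)) ∈ D :=
      (hmemD _).2 ⟨d, IsUnit.of_mul_eq_one c (by rw [mul_comm, hd]), fun l => -b l, 0,
        fun _ _ => rfl, by simp⟩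
    have h1 : (⟨_, hε⟩ : D) * ⟨_, hη⟩ = 1 := Subtype.ext (hs.mul_frozen_eq_one hd b)
    refine ⟨Units.mkOfMulEqOne _ _ h1, Subtype.ext ?_⟩
    show (prodD _ : F) * (algebraMap K F c * (∏ l, s.y l ^ b l)) = _
    rw [hcoe, hext, mul_comm]

end Divisors

/-! ### The cluster algebra and the upper cluster algebra are intermediate. -/

section ClusterAlgebra

variable [CharZero K] {s₀ s : SeedData n m F}

lemma isIntermediate_upperClusterAlgebra (hs₀ : s₀.IsPreseed K) (hs : s₀.MutEquiv s) :
    s.IsIntermediate K (s₀.upperClusterAlgebra K) := by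
  have hU : ∀ z, z ∈ s₀.upperClusterAlgebra K ↔ ∀ t, s₀.MutEquiv t → z ∈ t.laurent K := by
    intro z
    simp [upperClusterAlgebra, Algebra.mem_iInf]
  have hy : ∀ t, s₀.MutEquiv t → ∀ l, s.y l = t.vars (Sum.inr l) := by
    intro t ht l
    rw [hs.y_eq, ← ht.y_eq]
    rfl
  refine ⟨fun i => ?_, fun l => ?_, fun l => ?_, fun z hz => ?_, fun i z hz => ?_⟩
  · rw [hU]
    intro t ht
    exact MutEquiv.x_mem_laurent ((hs.symm hs₀).trans ht) (hs.isPreseed hs₀) i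
  · rw [hU]
    intro t ht
    rw [hy t ht]
    exact mem_laurentAlg _ _
  · rw [hU]
    intro t ht
    rw [hy t ht]
    exact inv_mem_laurentAlg _ _
  · exact (hU z).1 hz s hs
  · exact (hU z).1 hz _ (hs.tail ⟨i, rfl⟩)

lemma clusterAlgebra_le_upperClusterAlgebra (hs₀ : s₀.IsPreseed K) :
    s₀.clusterAlgebra K ≤ s₀.upperClusterAlgebra K := by
  have h := isIntermediate_upperClusterAlgebra hs₀ (Relation.ReflTransGen.refl : s₀.MutEquiv s₀)
  refine Algebra.adjoin_le ?_
  rintro _ ((⟨t, ht, i, rfl⟩ | ⟨l, rfl⟩) | ⟨l, rfl⟩)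
  · exact (isIntermediate_upperClusterAlgebra hs₀ ht).x_mem i
  · exact h.y_mem l
  · exact h.y_inv_mem l

lemma isIntermediate_clusterAlgebra (hs₀ : s₀.IsPreseed K) (hs : s₀.MutEquiv s) :
    s.IsIntermediate K (s₀.clusterAlgebra K) := by
  have h := isIntermediate_upperClusterAlgebra hs₀ hs
  have hle := clusterAlgebra_le_upperClusterAlgebra hs₀
  refine ⟨fun i => Algebra.subset_adjoin (Or.inl (Or.inl ⟨s, hs, i, rfl⟩)), fun l => ?_,
    fun l => ?_, hle.trans h.le_laurent, fun i => hle.trans (h.le_laurent_mutate i)⟩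
  · rw [hs.y_eq]
    exact Algebra.subset_adjoin (Or.inl (Or.inr ⟨l, rfl⟩))
  · rw [hs.y_eq]
    exact Algebra.subset_adjoin (Or.inr ⟨l, rfl⟩)

end ClusterAlgebra

end SeedData

end ClusterAlg

theorem proposition2p3 {K : Type*} [CommRing K] {F : Type*} [Field F] [Algebra K F] {n m : ℕ}
    (s₀ : ClusterAlg.SeedData n m F) (hs₀ : s₀.IsSeed K)
    (hK : (IsField K ∧ CharZero K ∧ ∀ k, ¬ s₀.IsIsolated k) ∨ Nonempty (K ≃+* ℤ))
    (s : ClusterAlg.SeedData n m F) (hs : s₀.MutEquiv s) (e : Fin n → ℕ) :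
    ∃ (hA : s.monomial e ∈ s₀.clusterAlgebra K) (hU : s.monomial e ∈ s₀.upperClusterAlgebra K)
      (D : Submonoid F),
      -- the divisor-closed submonoids in `𝒰` and in `𝒜`, as submonoids of `F`
      D = (ClusterAlg.divisorClosure {(⟨s.monomial e, hU⟩ : s₀.upperClusterAlgebra K)}).map
        (s₀.upperClusterAlgebra K).val ∧
      D = (ClusterAlg.divisorClosure {(⟨s.monomial e, hA⟩ : s₀.clusterAlgebra K)}).map
        (s₀.clusterAlgebra K).val ∧
      (D : Set F) = {z | ∃ (ε : (s₀.upperClusterAlgebra K)ˣ) (a : Fin n → ℕ),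
        (∀ i, e i = 0 → a i = 0) ∧
        z = ((ε : s₀.upperClusterAlgebra K) : F) * s.monomial a} ∧
      -- `D` modulo its units is free abelian on the classes of the `x_i` with `e_i ≠ 0`
      ∃ b : {i : Fin n // e i ≠ 0} → D, (∀ i, (b i : F) = s.x i) ∧
        ClusterAlg.IsFreeAbelianOn (fun i => Associates.mk (b i)) := by
  have hp₀ := hs₀.isPreseed
  have : IsDomain K := hs₀.algebraicIndependent.algebraMap_injective.isDomain
  have : CharZero K := by
    obtain ⟨-, h, -⟩ | ⟨⟨φ⟩⟩ := hK
    · exact h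
    · exact RingHom.charZero (φ : K →+* ℤ)
  -- The only place where the two cases for `K` differ: over a field isolated indices are excluded,
  -- a mutation-invariant condition, and over `ℤ` the element `2` is not invertible.
  have hi : ∀ i, ¬ s.IsIsolated i ∨ ¬ IsUnit (2 : K) := by
    intro i
    obtain ⟨-, -, h⟩ | ⟨⟨φ⟩⟩ := hK
    · exact Or.inl fun h' => h i ((hs.isIsolated_iff hp₀).1 h')
    · refine Or.inr fun h => ?_
      have h1 := h.map φ
      rw [map_ofNat, Int.isUnit_iff] at h1
      omega
  have hp := hs.isPreseed hp₀
  have hA := ClusterAlg.SeedData.isIntermediate_clusterAlgebra hp₀ hs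
  have hU := ClusterAlg.SeedData.isIntermediate_upperClusterAlgebra hp₀ hs
  have hDA := hA.coe_map_divisorClosure hp hi (hA.monomial_mem e)
  have hDU := hU.coe_map_divisorClosure hp hi (hU.monomial_mem e)
  exact ⟨hA.monomial_mem e, hU.monomial_mem e, _, rfl, SetLike.coe_injective (hDU.trans hDA.symm),
    hDU.trans (hU.unitMonomials_eq hp hi e), hp.exists_isFreeAbelianOn hDU⟩
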